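/- Work over $\mathbb{C}$. For integers $n,\ell\ge 0$ put $V=\mathbb{C}^n$, $G=GL(V)$, $\overline{R}=\mathfrak{sl}(V)^{\oplus \ell}\oplus V^*$, and identify, by the trace form, $T^*\overline{R}=\mathfrak{sl}(V)^{\oplus 2\ell}\oplus V^*\oplus V\ni (X_1,\dots,X_\ell,Y_1,\dots,Y_\ell,i,j)$, where $g\in G$ acts by $(gX_kg^{-1},gY_kg^{-1},ig^{-1},gj)$. Let $\mu(X,Y,i,j)=\sum_{k=1}^{\ell}[X_k,Y_k]-ji\in\mathfrak{gl}(V)$ be the moment map, let $\theta=\det^{-1}$, and let $\overline{\mathcal{M}}^{\theta}(n,\ell)=\mu^{-1}(0)^{\theta\text{-}ss}/\!/^{\theta}G$ be the GIT quotient; here a point is $\theta$-semistable if, for some $m>0$, some function $f\in\mathbb{C}[\mu^{-1}(0)]$ with $f(g^{-1}x)=\theta(g)^m f(x)$ for all $g\in G$, $x\in\mu^{-1}(0)$ does not vanish at it. The torus $T=(\mathbb{C}^*)^\ell$ acts on $T^*\overline{R}$ by $(t_1,\dots,t_\ell)\cdot(X,Y,i,j)=(t_1X_1,\dots,t_\ell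 X_\ell,t_1^{-1}Y_1,\dots,t_\ell^{-1}Y_\ell,i,j)$, and this action descends to $\overline{\mathcal{M}}^{\theta}(n,\ell)$. Theorem. Let $\ell\ge 1$ and $d\ge 1$ be integers and let $\tilde\nu:\mathbb{C}^*\to T$, $\tilde\nu(t)=(t^d,1,\dots,1)$. Then the fixed locus $\overline{\mathcal{M}}^{\theta}(2,\ell)^{\tilde\nu(\mathbb{C}^*)}$, as a (reduced) subvariety of $\overline{\mathcal{M}}^{\theta}(2,\ell)$, is isomorphic, as an algebraic variety, to the disjoint union $$\overline{\mathcal{M}}^{\theta}(2,\ell-1)\;\sqcup\;\mathbb{C}^{2\ell-2}\;\sqcup\;\mathbb{C}^{2\ell-2}.$$ -/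

import Mathlib

open Topology

noncomputable section

/-! ### Complex varieties as spaces with functions -/

/-- A topological space together with a sheaf of `ℂ`-algebras of `ℂ`-valued functions.
The sheaf is recorded by the predicate "`f` is regular in a neighbourhood of `x`":
the sections over an open set `U` are the functions on `U` that are regular at all points of `U`
(for a function on `U`, extended to the whole space in any way, this does not depend on the
extension, by `germ`).  Classical complex algebraic varieties with their Zariski topology and their
regular functions are spaces of this kind, and they form a full subcategory. -/
structure FunctionSpace where
  carrier : Type
  top : TopologicalSpace carrier
  RegularAt : (carrier → ℂ) → carrier → Prop
  germ : ∀ {f g : carrier → ℂ} {x : carrier},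
    (∀ᶠ y in 𝓝 x, f y = g y) → RegularAt f x → RegularAt g x
  nearby : ∀ {f : carrier → ℂ} {x : carrier}, RegularAt f x → ∀ᶠ y in 𝓝 x, RegularAt f y
  const : ∀ (c : ℂ) (x : carrier), RegularAt (fun _ => c) x
  add : ∀ {f g : carrier → ℂ} {x : carrier},
    RegularAt f x → RegularAt g x → RegularAt (fun y => f y + g y) x
  mul : ∀ {f g : carrier → ℂ} {x : carrier},
    RegularAt f x → RegularAt g x → RegularAt (fun y => f y * g y) x

namespace FunctionSpace

instance (X : FunctionSpace) : TopologicalSpace X.carrier := X.top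

/-- An isomorphism: a homeomorphism that identifies the sheaves of regular functions. -/
structure Iso (X Y : FunctionSpace) where
  toHomeomorph : X.carrier ≃ₜ Y.carrier
  regularAt_iff : ∀ (f : Y.carrier → ℂ) (x : X.carrier),
    X.RegularAt (fun z => f (toHomeomorph z)) x ↔ Y.RegularAt f (toHomeomorph x)

/-- The structure induced on a subset `S`: the subspace topology, and the functions that are
locally restrictions of regular functions.  For a closed subset of a variety this is the structure
of a reduced closed subvariety, for an open subset that of an open subvariety. -/
def induced (X : FunctionSpace) (S : Set X.carrier) : FunctionSpace where
  carrier := S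
  top := inferInstance
  RegularAt f x := ∃ g : X.carrier → ℂ, X.RegularAt g x ∧ ∀ᶠ y : S in 𝓝 x, g y = f y
  germ := by
    rintro f g x h ⟨k, hk, hkf⟩
    refine ⟨k, hk, ?_⟩
    filter_upwards [h, hkf] with y h1 h2 using h2.trans h1
  nearby := by
    rintro f x ⟨k, hk, hkf⟩
    have h1 : ∀ᶠ y : S in 𝓝 x, X.RegularAt k y :=
      continuous_subtype_val.continuousAt.eventually (X.nearby hk)
    filter_upwards [h1, hkf.eventually_nhds] with y h1 h2 using ⟨k, h1, h2⟩
  const c x := ⟨fun _ => c, X.const c x, Filter.Eventually.of_forall fun _ => rfl⟩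
  add := by
    rintro f g x ⟨k, hk, hkf⟩ ⟨l, hl, hlg⟩
    refine ⟨_, X.add hk hl, ?_⟩
    filter_upwards [hkf, hlg] with y h1 h2
    rw [h1, h2]
  mul := by
    rintro f g x ⟨k, hk, hkf⟩ ⟨l, hl, hlg⟩
    refine ⟨_, X.mul hk hl, ?_⟩
    filter_upwards [hkf, hlg] with y h1 h2
    rw [h1, h2]

/-- The quotient by (the equivalence relation generated by) `r`: the quotient topology, and the
functions whose pullback is regular. -/
def quotient (X : FunctionSpace) (r : X.carrier → X.carrier → Prop) : FunctionSpace where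
  carrier := Quot r
  top := inferInstance
  RegularAt f p := ∀ᶠ q in 𝓝 p, ∀ x : X.carrier, Quot.mk r x = q →
    X.RegularAt (fun y => f (Quot.mk r y)) x
  germ := by
    intro f g p h hf
    filter_upwards [h.eventually_nhds, hf] with q h1 h2 x hx
    subst hx
    exact X.germ (continuous_quot_mk.continuousAt.eventually h1) (h2 x rfl)
  nearby := fun h => h.eventually_nhds
  const c p := Filter.Eventually.of_forall fun _ x _ => X.const c x
  add := by
    intro f g p hf hg
    filter_upwards [hf, hg] with q h1 h2 x hx using X.add (h1 x hx) (h2 x hx)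
  mul := by
    intro f g p hf hg
    filter_upwards [hf, hg] with q h1 h2 x hx using X.mul (h1 x hx) (h2 x hx)

/-- The disjoint union. -/
def coprod (X Y : FunctionSpace) : FunctionSpace where
  carrier := X.carrier ⊕ Y.carrier
  top := inferInstance
  RegularAt f p := match p with
    | .inl x => X.RegularAt (fun z => f (.inl z)) x
    | .inr y => Y.RegularAt (fun z => f (.inr z)) y
  germ := by
    rintro f g (x | y) h hf
    · exact X.germ (continuous_inl.continuousAt.eventually h) hf
    · exact Y.germ (continuous_inr.continuousAt.eventually h) hf
  nearby := by
    rintro f (x | y) hf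
    · rw [nhds_inl, Filter.eventually_map]
      exact X.nearby hf
    · rw [nhds_inr, Filter.eventually_map]
      exact Y.nearby hf
  const := by
    rintro c (x | y)
    · exact X.const c x
    · exact Y.const c y
  add := by
    rintro f g (x | y) hf hg
    · exact X.add hf hg
    · exact Y.add hf hg
  mul := by
    rintro f g (x | y) hf hg
    · exact X.mul hf hg
    · exact Y.mul hf hg

end FunctionSpace

/-! ### Vector spaces as affine varieties -/

section Affine

variable (W : Type) [AddCommGroup W] [Module ℂ W]

/-- The algebra of polynomial functions on a complex vector space, generated by the linear forms. -/
def polyFun : Subalgebra ℂ (W → ℂ) :=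
  Algebra.adjoin ℂ {f : W → ℂ | ∃ φ : Module.Dual ℂ W, f = fun w => φ w}

/-- The Zariski topology: the sets `{q ≠ 0}`, for `q` a polynomial function, form a basis. -/
@[reducible] def zariskiTopology : TopologicalSpace W :=
  TopologicalSpace.generateFrom {U : Set W | ∃ q ∈ polyFun W, U = {w | q w ≠ 0}}

theorem isTopologicalBasis_zariski :
    @TopologicalSpace.IsTopologicalBasis W (zariskiTopology W)
      {U : Set W | ∃ q ∈ polyFun W, U = {w | q w ≠ 0}} := by
  let _ := zariskiTopology W
  refine ⟨?_, ?_, rfl⟩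
  · rintro _ ⟨p, hp, rfl⟩ _ ⟨q, hq, rfl⟩ x hx
    refine ⟨_, ⟨p * q, mul_mem hp hq, rfl⟩, ?_, ?_⟩
    · exact mul_ne_zero hx.1 hx.2
    · intro y hy
      exact ⟨left_ne_zero_of_mul hy, right_ne_zero_of_mul hy⟩
  · refine Set.eq_univ_of_forall fun x => ?_
    exact Set.mem_sUnion.2 ⟨_, ⟨1, one_mem _, rfl⟩, one_ne_zero⟩

/-- A complex vector space as an affine variety: near `x`, a regular function is a quotient `p / q`
of polynomial functions with `q x ≠ 0`. -/
def affineSpace : FunctionSpace where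
  carrier := W
  top := zariskiTopology W
  RegularAt f x := ∃ p ∈ polyFun W, ∃ q ∈ polyFun W, q x ≠ 0 ∧ ∀ y, q y ≠ 0 → f y = p y / q y
  germ := by
    rintro f g x h ⟨p, hp, q, hq, hx, hf⟩
    let _ := zariskiTopology W
    obtain ⟨_, ⟨s, hs, rfl⟩, hsx, hsub⟩ :=
      (isTopologicalBasis_zariski W).mem_nhds_iff.1 h
    refine ⟨p * s, mul_mem hp hs, q * s, mul_mem hq hs, mul_ne_zero hx hsx, fun y hy => ?_⟩
    have hqy : q y ≠ 0 := left_ne_zero_of_mul hy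
    have hsy : s y ≠ 0 := right_ne_zero_of_mul hy
    have : f y = g y := hsub hsy
    rw [← this, hf y hqy]
    exact (mul_div_mul_right _ _ hsy).symm
  nearby := by
    rintro f x ⟨p, hp, q, hq, hx, hf⟩
    let _ := zariskiTopology W
    refine (isTopologicalBasis_zariski W).mem_nhds_iff.2
      ⟨_, ⟨q, hq, rfl⟩, hx, fun y hy => ⟨p, hp, q, hq, hy, hf⟩⟩
  const c x := ⟨algebraMap ℂ _ c, Subalgebra.algebraMap_mem _ c, 1, one_mem _, one_ne_zero,
    fun y _ => (div_one c).symm⟩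
  add := by
    rintro f g x ⟨p, hp, q, hq, hx, hf⟩ ⟨p', hp', q', hq', hx', hg⟩
    refine ⟨p * q' + q * p', add_mem (mul_mem hp hq') (mul_mem hq hp'), q * q', mul_mem hq hq',
      mul_ne_zero hx hx', fun y hy => ?_⟩
    have h1 : q y ≠ 0 := left_ne_zero_of_mul hy
    have h2 : q' y ≠ 0 := right_ne_zero_of_mul hy
    show f y + g y = _
    rw [hf y h1, hg y h2]
    exact div_add_div _ _ h1 h2
  mul := by
    rintro f g x ⟨p, hp, q, hq, hx, hf⟩ ⟨p', hp', q', hq', hx', hg⟩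
    refine ⟨p * p', mul_mem hp hp', q * q', mul_mem hq hq',
      mul_ne_zero hx hx', fun y hy => ?_⟩
    have h1 : q y ≠ 0 := left_ne_zero_of_mul hy
    have h2 : q' y ≠ 0 := right_ne_zero_of_mul hy
    show f y * g y = _
    rw [hf y h1, hg y h2]
    exact div_mul_div_comm _ _ _ _

end Affine

theorem polyFun_comp {W W' : Type} [AddCommGroup W] [Module ℂ W] [AddCommGroup W'] [Module ℂ W']
    (a : W →ₗ[ℂ] W') {f : W' → ℂ} (hf : f ∈ polyFun W') : (fun w => f (a w)) ∈ polyFun W := by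
  induction hf using Algebra.adjoin_induction with
  | mem f hf =>
    obtain ⟨φ, rfl⟩ := hf
    exact Algebra.subset_adjoin ⟨φ.comp a, rfl⟩
  | algebraMap c => exact Subalgebra.algebraMap_mem _ c
  | add f g _ _ h1 h2 => exact add_mem h1 h2
  | mul f g _ _ h1 h2 => exact mul_mem h1 h2

theorem continuous_zariski_linear {W : Type} [AddCommGroup W] [Module ℂ W] (a : W →ₗ[ℂ] W) :
    Continuous[zariskiTopology W, zariskiTopology W] a := by
  let _ := zariskiTopology W
  refine (isTopologicalBasis_zariski W).continuous_iff.2 ?_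
  rintro _ ⟨q, hq, rfl⟩
  exact (isTopologicalBasis_zariski W).isOpen ⟨_, polyFun_comp a hq, rfl⟩

/-! ### GIT quotients -/

section GIT

variable {G T W : Type} [Group G] [Group T] [AddCommGroup W] [Module ℂ W]

/-- The `θ`-semistable points of a closed `G`-stable subset `Z` of a representation: some function
`f` on `Z` in the weight space `ℂ[Z]^{G, θ ^ m}` with `m > 0`, for the action
`(g • f) z = f (g⁻¹ z)`, does not vanish there. -/
def semistable (ρ : Representation ℂ G W) (θ : G →* ℂˣ) (Z : Set W) : Set W :=
  {x | x ∈ Z ∧ ∃ m : ℕ, 0 < m ∧ ∃ f ∈ polyFun W,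
    (∀ g : G, ∀ z ∈ Z, f (ρ g⁻¹ z) = ((θ g : ℂˣ) : ℂ) ^ m * f z) ∧ f x ≠ 0}

/-- The semistable locus with its variety structure. -/
def semistableSpace (ρ : Representation ℂ G W) (θ : G →* ℂˣ) (Z : Set W) : FunctionSpace :=
  FunctionSpace.induced (affineSpace W) (semistable ρ θ Z : Set W)

/-- The `G`-orbit of a semistable point. -/
def semistableOrbit (ρ : Representation ℂ G W) (θ : G →* ℂˣ) (Z : Set W)
    (x : (semistableSpace ρ θ Z).carrier) : Set (semistableSpace ρ θ Z).carrier :=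
  {y | ∃ g : G, (y.1 : W) = ρ g (x.1 : W)}

/-- Two semistable points have the same image in the GIT quotient when the closures of their
orbits in the semistable locus intersect. -/
def orbitClosuresMeet (ρ : Representation ℂ G W) (θ : G →* ℂˣ) (Z : Set W)
    (x y : (semistableSpace ρ θ Z).carrier) : Prop :=
  (closure (semistableOrbit ρ θ Z x) ∩ closure (semistableOrbit ρ θ Z y)).Nonempty

/-- The GIT quotient `Z^{θ-ss} //^θ G`: its points are the semistable points up to the relation
above, its topology is the quotient topology, and its regular functions are the invariant regular
functions upstairs. -/
def gitQuotient (ρ : Representation ℂ G W) (θ : G →* ℂˣ) (Z : Set W) : FunctionSpace :=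
  (semistableSpace ρ θ Z).quotient (orbitClosuresMeet ρ θ Z)

variable (ρ : Representation ℂ G W) (θ : G →* ℂˣ) (Z : Set W) (τ : Representation ℂ T W)

theorem semistable_map (hcomm : ∀ t g w, τ t (ρ g w) = ρ g (τ t w))
    (hZ : ∀ t, ∀ z ∈ Z, τ t z ∈ Z) (t : T) {x : W} (hx : x ∈ semistable ρ θ Z) :
    τ t x ∈ semistable ρ θ Z := by
  obtain ⟨hxZ, m, hm, f, hf, hinv, hfx⟩ := hx
  refine ⟨hZ t x hxZ, m, hm, fun w => f (τ t⁻¹ w), polyFun_comp _ hf, fun g z hz => ?_, ?_⟩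
  · show f (τ t⁻¹ (ρ g⁻¹ z)) = _
    rw [hcomm]
    exact hinv g _ (hZ _ _ hz)
  · show f (τ t⁻¹ (τ t x)) ≠ 0
    simpa using hfx

/-- A linear action commuting with `G` and preserving `Z`, on the semistable locus. -/
def semistableAct (hcomm : ∀ t g w, τ t (ρ g w) = ρ g (τ t w))
    (hZ : ∀ t, ∀ z ∈ Z, τ t z ∈ Z) (t : T) (x : (semistableSpace ρ θ Z).carrier) :
    (semistableSpace ρ θ Z).carrier :=
  ⟨τ t x.1, semistable_map ρ θ Z τ hcomm hZ t x.2⟩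

theorem continuous_semistableAct (hcomm : ∀ t g w, τ t (ρ g w) = ρ g (τ t w))
    (hZ : ∀ t, ∀ z ∈ Z, τ t z ∈ Z) (t : T) :
    Continuous (semistableAct ρ θ Z τ hcomm hZ t) := by
  let _ := zariskiTopology W
  exact Continuous.subtype_mk ((continuous_zariski_linear (τ t)).comp continuous_subtype_val) _

theorem semistableAct_closure (hcomm : ∀ t g w, τ t (ρ g w) = ρ g (τ t w))
    (hZ : ∀ t, ∀ z ∈ Z, τ t z ∈ Z) (t : T) {x z : (semistableSpace ρ θ Z).carrier}
    (hz : z ∈ closure (semistableOrbit ρ θ Z x)) :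
    semistableAct ρ θ Z τ hcomm hZ t z ∈
      closure (semistableOrbit ρ θ Z (semistableAct ρ θ Z τ hcomm hZ t x)) := by
  refine map_mem_closure (continuous_semistableAct ρ θ Z τ hcomm hZ t) hz ?_
  rintro y ⟨g, hg⟩
  refine ⟨g, ?_⟩
  show τ t y.1 = ρ g (τ t x.1)
  exact (congrArg (τ t) hg).trans (hcomm t g x.1)

/-- A linear action commuting with `G` and preserving `Z` descends to the GIT quotient. -/
def gitAct (hcomm : ∀ t g w, τ t (ρ g w) = ρ g (τ t w))
    (hZ : ∀ t, ∀ z ∈ Z, τ t z ∈ Z) (t : T) :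
    (gitQuotient ρ θ Z).carrier → (gitQuotient ρ θ Z).carrier :=
  Quot.map (semistableAct ρ θ Z τ hcomm hZ t) fun _ _ ⟨z, hx, hy⟩ =>
    ⟨semistableAct ρ θ Z τ hcomm hZ t z, semistableAct_closure ρ θ Z τ hcomm hZ t hx,
      semistableAct_closure ρ θ Z τ hcomm hZ t hy⟩

end GIT

/-! ### The quiver variety -/

open LieAlgebra.SpecialLinear in
/-- The space `𝔰𝔩(V)^ℓ ⊕ 𝔰𝔩(V)^ℓ ⊕ V^* ⊕ V` with `V = ℂⁿ`, which is the cotangent bundle of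
`𝔰𝔩(V)^ℓ ⊕ V^*` via the trace form.  Its points are the tuples `(X, Y, i, j)`, with `i` a row
vector and `j` a column vector. -/
abbrev QuiverRep (n ℓ : ℕ) : Type :=
  (Fin ℓ → sl (Fin n) ℂ) × (Fin ℓ → sl (Fin n) ℂ) × (Fin n → ℂ) × (Fin n → ℂ)

/-- Conjugation `A ↦ g A g⁻¹` on traceless matrices. -/
def slConj {n : ℕ} (g : GL (Fin n) ℂ) :
    LieAlgebra.SpecialLinear.sl (Fin n) ℂ →ₗ[ℂ] LieAlgebra.SpecialLinear.sl (Fin n) ℂ where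
  toFun A := ⟨(g : Matrix (Fin n) (Fin n) ℂ) * A.1 * (g⁻¹ : GL (Fin n) ℂ).1, by
    have h : Matrix.trace A.1 = 0 := A.2
    show Matrix.trace ((g : Matrix (Fin n) (Fin n) ℂ) * A.1 * (g⁻¹ : GL (Fin n) ℂ).1) = 0
    rw [Matrix.trace_mul_comm, ← mul_assoc, Units.inv_mul, one_mul, h]⟩
  map_add' A B := Subtype.ext (by simp [mul_add, add_mul])
  map_smul' c A := Subtype.ext (by simp)

/-- The action of `GL(V)`: `g (X, Y, i, j) = (g X g⁻¹, g Y g⁻¹, i g⁻¹, g j)`. -/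
def glRep (n ℓ : ℕ) : Representation ℂ (GL (Fin n) ℂ) (QuiverRep n ℓ) where
  toFun g :=
    { toFun := fun p => (fun k => slConj g (p.1 k), fun k => slConj g (p.2.1 k),
        Matrix.vecMul p.2.2.1 (g⁻¹ : GL (Fin n) ℂ).1, Matrix.mulVec g.1 p.2.2.2)
      map_add' := fun p q => by
        ext <;> simp [Matrix.add_vecMul, Matrix.mulVec_add]
      map_smul' := fun c p => by
        ext <;> simp [Matrix.smul_vecMul, Matrix.mulVec_smul] }
  map_one' := by
    ext <;> simp [slConj]
  map_mul' g h := by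
    refine LinearMap.ext fun p => ?_
    refine Prod.ext ?_ (Prod.ext ?_ (Prod.ext ?_ ?_))
    · funext k; apply Subtype.ext; simp [slConj, mul_assoc]
    · funext k; apply Subtype.ext; simp [slConj, mul_assoc]
    · simp [Matrix.vecMul_vecMul]
    · simp [Matrix.mulVec_mulVec]

/-- The action of the torus `T = (ℂˣ)^ℓ`: it rescales the `X k`, hence, on the cotangent bundle,
`t (X, Y, i, j) = ((t k) X k, (t k)⁻¹ Y k, i, j)`. -/
def torusRep (n ℓ : ℕ) : Representation ℂ (Fin ℓ → ℂˣ) (QuiverRep n ℓ) where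
  toFun t :=
    { toFun := fun p => (fun k => (t k : ℂ) • p.1 k, fun k => ((t k)⁻¹ : ℂˣ).1 • p.2.1 k,
        p.2.2.1, p.2.2.2)
      map_add' := fun p q => by
        refine Prod.ext ?_ (Prod.ext ?_ rfl) <;> funext k <;> exact smul_add _ _ _
      map_smul' := fun c p => by
        refine Prod.ext ?_ (Prod.ext ?_ rfl) <;> funext k
        · exact smul_comm (t k : ℂ) c (p.1 k)
        · exact smul_comm ((t k)⁻¹ : ℂˣ).1 c (p.2.1 k) }
  map_one' := by
    refine LinearMap.ext fun p => ?_
    refine Prod.ext ?_ (Prod.ext ?_ rfl) <;> funext k <;> simp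
  map_mul' s t := by
    refine LinearMap.ext fun p => ?_
    refine Prod.ext ?_ (Prod.ext ?_ rfl) <;> funext k
    · simp [mul_smul]
    · simp [smul_smul, mul_comm]

/-- The moment map `μ(X, Y, i, j) = ∑ [X k, Y k] - j i`. -/
def momentMap (n ℓ : ℕ) (p : QuiverRep n ℓ) : Matrix (Fin n) (Fin n) ℂ :=
  (∑ k, ((p.1 k).1 * (p.2.1 k).1 - (p.2.1 k).1 * (p.1 k).1)) - Matrix.vecMulVec p.2.2.2 p.2.2.1

/-- The zero fibre of the moment map. -/
def momentZero (n ℓ : ℕ) : Set (QuiverRep n ℓ) := {p | momentMap n ℓ p = 0}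

/-- The character `θ = det⁻¹` of `GL(V)`. -/
def detInv (n : ℕ) : GL (Fin n) ℂ →* ℂˣ := (Matrix.GeneralLinearGroup.det)⁻¹

/-- The Nakajima quiver variety `μ⁻¹(0)^{θ-ss} //^θ GL(V)` with traceless loops, for the quiver with
one vertex, `ℓ` loops and a one-dimensional framing, `dim V = n` and `θ = det⁻¹`. -/
def quiverVariety (n ℓ : ℕ) : FunctionSpace :=
  gitQuotient (glRep n ℓ) (detInv n) (momentZero n ℓ)

theorem torusRep_comm (n ℓ : ℕ) (t : Fin ℓ → ℂˣ) (g : GL (Fin n) ℂ) (w : QuiverRep n ℓ) :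
    torusRep n ℓ t (glRep n ℓ g w) = glRep n ℓ g (torusRep n ℓ t w) := by
  refine Prod.ext ?_ (Prod.ext ?_ rfl) <;> funext k
  · exact ((slConj g).map_smul _ _).symm
  · exact ((slConj g).map_smul _ _).symm

theorem torusRep_momentZero (n ℓ : ℕ) (t : Fin ℓ → ℂˣ) (z : QuiverRep n ℓ)
    (hz : z ∈ momentZero n ℓ) : torusRep n ℓ t z ∈ momentZero n ℓ := by
  have h : momentMap n ℓ (torusRep n ℓ t z) = momentMap n ℓ z := by
    simp [momentMap, torusRep, smul_smul]
  show momentMap n ℓ _ = 0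
  rw [h]
  exact hz

/-- The action of the torus `T` on the quiver variety. -/
def torusAct (n ℓ : ℕ) (t : Fin ℓ → ℂˣ) :
    (quiverVariety n ℓ).carrier → (quiverVariety n ℓ).carrier :=
  gitAct (glRep n ℓ) (detInv n) (momentZero n ℓ) (torusRep n ℓ) (torusRep_comm n ℓ)
    (torusRep_momentZero n ℓ) t

/-- The one-parameter subgroup `t ↦ (t ^ d, 1, …, 1)` of `T = (ℂˣ)^ℓ`. -/
def nuTilde (ℓ d : ℕ) : ℂˣ →* (Fin ℓ → ℂˣ) where
  toFun t := fun k => if (k : ℕ) = 0 then t ^ d else 1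
  map_one' := by funext k; simp
  map_mul' s t := by funext k; by_cases h : (k : ℕ) = 0 <;> simp [h, mul_pow]

/-- The locus of points of the quiver variety fixed by a one-parameter subgroup `ν` of `T`, with its
structure of a subvariety. -/
def fixedLocus (n ℓ : ℕ) (ν : ℂˣ →* (Fin ℓ → ℂˣ)) : FunctionSpace :=
  (quiverVariety n ℓ).induced {p | ∀ t : ℂˣ, torusAct n ℓ (ν t) p = p}

end

/-! Because `n = 2`, a point of `μ⁻¹(0)` is `det⁻¹`-semistable exactly when `j` and `A j` form a
basis of `V` for some loop `A` among the `X k`, `Y k` (`mem_semistable_iff`): otherwise the span of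
`j` is stable under all loops, and a one-parameter subgroup destabilises the point. Where `(j, A j)`
is a basis, exactly one group element carries it to the standard basis. Hence semistable points are
identified in the quotient only along orbits (`orbitClosuresMeet_iff`), and the normal form is a
regular section over this open set (`morAt_normalSection`).

Take a fixed point in normal form for `A`, and `t` with `t ^ d = 2`. The group element that realises
the action of `t` must be `diag(1, w)`, with `w` the torus weight of `A`
(`eq_diagonal_of_torusRep_eq`), so every matrix entry satisfies a weight equation
(`entries_of_torusRep_eq`). If `A` is neither `X 0` nor `Y 0`, then `w = 1` and the equations kill
`X 0` and `Y 0`; what remains is a point of the variety with one loop less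
(`loopMat_endIdx_of_fixed`). If `A` is `X 0` or `Y 0`, then `w` is `2` or `1/2`; the other loop of
the first pair becomes strictly upper triangular and the remaining ones diagonal. The moment
equation then kills that other loop and what is left of `i`, and the `2ℓ - 2` diagonal entries stay
free (`eq_chartRep_of_fixed`).

The three pieces are separated by the open loci where `(j, X 0 j)` or `(j, Y 0 j)` is a basis.
Together they give an injective morphism onto the fixed locus, and normal forms provide local
sections of it, so it is an isomorphism (`nonempty_iso_of_local_sections`). -/

namespace FunctionSpace

/-! ### Morphisms of spaces with functions -/

/-- `f` is a morphism of spaces with functions at the point `x`. -/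
structure MorAt (X Y : FunctionSpace) (f : X.carrier → Y.carrier) (x : X.carrier) : Prop where
  continuousAt : ContinuousAt f x
  regularAt : ∀ h : Y.carrier → ℂ, Y.RegularAt h (f x) → X.RegularAt (fun z => h (f z)) x

/-- `f` is a morphism of spaces with functions. -/
def IsMor (X Y : FunctionSpace) (f : X.carrier → Y.carrier) : Prop := ∀ x, MorAt X Y f x

variable {X Y Z : FunctionSpace}

theorem IsMor.continuous {f : X.carrier → Y.carrier} (hf : IsMor X Y f) : Continuous f :=
  continuous_iff_continuousAt.2 fun x => (hf x).continuousAt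

theorem MorAt.comp {g : Y.carrier → Z.carrier} {f : X.carrier → Y.carrier} {x : X.carrier}
    (hg : MorAt Y Z g (f x)) (hf : MorAt X Y f x) : MorAt X Z (fun z => g (f z)) x :=
  ⟨hg.continuousAt.comp hf.continuousAt, fun h hh => hf.regularAt _ (hg.regularAt h hh)⟩

theorem IsMor.comp {g : Y.carrier → Z.carrier} {f : X.carrier → Y.carrier}
    (hg : IsMor Y Z g) (hf : IsMor X Y f) : IsMor X Z (fun z => g (f z)) :=
  fun x => (hg (f x)).comp (hf x)

theorem MorAt.congr {f g : X.carrier → Y.carrier} {x : X.carrier} (hf : MorAt X Y f x)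
    (h : ∀ᶠ z in 𝓝 x, f z = g z) : MorAt X Y g x := by
  refine ⟨hf.continuousAt.congr h, fun k hk => ?_⟩
  rw [← h.self_of_nhds] at hk
  exact X.germ (h.mono fun z hz => congrArg k hz) (hf.regularAt k hk)

theorem isMor_val (S : Set X.carrier) : IsMor (X.induced S) X Subtype.val := fun _ =>
  ⟨continuous_subtype_val.continuousAt,
    fun h hh => ⟨h, hh, Filter.Eventually.of_forall fun _ => rfl⟩⟩

/-- A regular function on the subspace agrees near `f x` with a regular function of the ambient
space, and continuity pulls this agreement back to a neighbourhood of `x`. -/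
theorem MorAt.codRestrict {S : Set Y.carrier} {f : X.carrier → (Y.induced S).carrier}
    {x : X.carrier} (hf : MorAt X Y (fun z => (f z).1) x) : MorAt X (Y.induced S) f x := by
  have hc : ContinuousAt f x := (Topology.IsInducing.subtypeVal.continuousAt_iff).2 hf.continuousAt
  refine ⟨hc, ?_⟩
  rintro h ⟨g, hg, hgh⟩
  exact X.germ (hc.eventually hgh) (hf.regularAt g hg)

theorem isMor_mk (r : X.carrier → X.carrier → Prop) : IsMor X (X.quotient r) (Quot.mk r) :=
  fun x => ⟨continuous_quot_mk.continuousAt, fun _ hh => hh.self_of_nhds x rfl⟩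

/-- A map from a quotient is a morphism over an open set if its pullback is one. -/
theorem morAt_quotient {r : X.carrier → X.carrier → Prop} {f : (X.quotient r).carrier → Y.carrier}
    {U : Set (X.quotient r).carrier} (hU : IsOpen U)
    (hf : ∀ x, Quot.mk r x ∈ U → MorAt X Y (fun z => f (Quot.mk r z)) x)
    {p : (X.quotient r).carrier} (hp : p ∈ U) : MorAt (X.quotient r) Y f p := by
  have hc : ∀ q ∈ U, ContinuousAt f q := by
    intro q hq V hV
    obtain ⟨V', hV', hVo, hqV⟩ := mem_nhds_iff.1 hV
    -- Openness in a quotient is tested upstairs, and this uses `hf` at all points over `U`, not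
    -- only over one point.
    have ho : IsOpen (U ∩ f ⁻¹' V') := by
      refine isOpen_coinduced.2 (isOpen_iff_mem_nhds.2 ?_)
      rintro x ⟨hxU, hxV⟩
      have h1 : ∀ᶠ z in 𝓝 x, Quot.mk r z ∈ U :=
        continuous_quot_mk.continuousAt.eventually (hU.mem_nhds hxU)
      have h2 := (hf x hxU).continuousAt.eventually (hVo.mem_nhds hxV)
      filter_upwards [h1, h2] with z hz1 hz2 using ⟨hz1, hz2⟩
    exact Filter.mem_map.2 (Filter.mem_of_superset (ho.mem_nhds ⟨hq, hqV⟩) fun z hz => hV' hz.2)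
  refine ⟨hc p hp, fun h hh => ?_⟩
  have h1 := (hc p hp).eventually (Y.nearby hh)
  filter_upwards [h1, hU.mem_nhds hp] with q hq hqU x hx
  subst hx
  exact (hf x hqU).regularAt h hq

theorem isMor_quotient {r : X.carrier → X.carrier → Prop} {f : (X.quotient r).carrier → Y.carrier}
    (hf : IsMor X Y (fun z => f (Quot.mk r z))) : IsMor (X.quotient r) Y f := fun _ =>
  morAt_quotient isOpen_univ (fun x _ => hf x) (Set.mem_univ _)

theorem isMor_inl : IsMor X (X.coprod Y) Sum.inl := fun _ =>
  ⟨continuous_inl.continuousAt, fun _ hh => hh⟩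

theorem isMor_inr : IsMor Y (X.coprod Y) Sum.inr := fun _ =>
  ⟨continuous_inr.continuousAt, fun _ hh => hh⟩

theorem isMor_sumElim {f : X.carrier → Z.carrier} {g : Y.carrier → Z.carrier}
    (hf : IsMor X Z f) (hg : IsMor Y Z g) : IsMor (X.coprod Y) Z (Sum.elim f g) := by
  have hc : Continuous (Sum.elim f g) := hf.continuous.sumElim hg.continuous
  rintro (x | y)
  · exact ⟨hc.continuousAt, fun h hh => (hf x).regularAt h hh⟩
  · exact ⟨hc.continuousAt, fun h hh => (hg y).regularAt h hh⟩

/-- An injective morphism with local sections is an isomorphism. -/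
theorem nonempty_iso_of_local_sections {ψ : Y.carrier → X.carrier} (hψ : IsMor Y X ψ)
    (hinj : Function.Injective ψ)
    (hloc : ∀ p, ∃ e : X.carrier → Y.carrier, MorAt X Y e p ∧ ∀ᶠ q in 𝓝 p, ψ (e q) = q) :
    Nonempty (Iso X Y) := by
  have hsurj : Function.Surjective ψ := fun p => by
    obtain ⟨e, -, he⟩ := hloc p
    exact ⟨e p, he.self_of_nhds⟩
  let φ := (Equiv.ofBijective ψ ⟨hinj, hsurj⟩).symm
  have hφψ : ∀ y, φ (ψ y) = y := (Equiv.ofBijective ψ ⟨hinj, hsurj⟩).symm_apply_apply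
  have hψφ : ∀ x, ψ (φ x) = x := (Equiv.ofBijective ψ ⟨hinj, hsurj⟩).apply_symm_apply
  -- By injectivity of `ψ`, any local section coincides with the inverse map.
  have hφ : IsMor X Y φ := fun p => by
    obtain ⟨e, hm, he⟩ := hloc p
    refine hm.congr (he.mono fun q hq => ?_)
    rw [← hφψ (e q), hq]
  refine ⟨⟨⟨φ, hφ.continuous, hψ.continuous⟩, fun f x => ⟨fun h => ?_, (hφ x).regularAt f⟩⟩⟩
  have h' : X.RegularAt (fun z => f (φ z)) (ψ (φ x)) := by rw [hψφ]; exact h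
  have := (hψ (φ x)).regularAt _ h'
  simp only [hφψ] at this
  exact this

end FunctionSpace

/-! ### Polynomial and rational maps between vector spaces -/

section Polynomial

variable {W W' : Type} [AddCommGroup W] [Module ℂ W] [AddCommGroup W'] [Module ℂ W']

/-- Maps between vector spaces with polynomial coordinates. -/
def IsPolyMap (F : W → W') : Prop := ∀ φ : Module.Dual ℂ W', (fun w => φ (F w)) ∈ polyFun W

theorem dual_mem_polyFun (φ : Module.Dual ℂ W) : (fun w => φ w) ∈ polyFun W :=
  Algebra.subset_adjoin ⟨φ, rfl⟩

theorem const_mem_polyFun (c : ℂ) : (fun _ : W => c) ∈ polyFun W :=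
  Subalgebra.algebraMap_mem _ c

theorem LinearMap.isPolyMap (a : W →ₗ[ℂ] W') : IsPolyMap a := fun φ =>
  dual_mem_polyFun (φ.comp a)

theorem isPolyMap_const (w : W') : IsPolyMap (fun _ : W => w) := fun φ =>
  const_mem_polyFun (φ w)

theorem IsPolyMap.smul {f : W → ℂ} {F : W → W'} (hf : f ∈ polyFun W) (hF : IsPolyMap F) :
    IsPolyMap (fun w => f w • F w) := fun φ => by
  simp only [map_smul, smul_eq_mul]
  exact mul_mem hf (hF φ)

theorem IsPolyMap.prodMk {W'' : Type} [AddCommGroup W''] [Module ℂ W''] {F : W → W'}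
    {F' : W → W''} (hF : IsPolyMap F) (hF' : IsPolyMap F') :
    IsPolyMap (fun w => (F w, F' w)) := fun φ => by
  have h : ∀ w, φ (F w, F' w) = φ (LinearMap.inl ℂ W' W'' (F w)) +
      φ (LinearMap.inr ℂ W' W'' (F' w)) := fun w => by
    rw [← map_add]; simp
  simp only [h]
  exact add_mem (hF (φ.comp (LinearMap.inl ℂ W' W''))) (hF' (φ.comp (LinearMap.inr ℂ W' W'')))

theorem IsPolyMap.pi {ι : Type} [Fintype ι] [DecidableEq ι] {F : W → ι → W'}
    (hF : ∀ k, IsPolyMap fun w => F w k) : IsPolyMap F := fun φ => by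
  have h : (fun w => φ (F w)) = ∑ k, fun w => φ (LinearMap.single ℂ (fun _ => W') k (F w k)) := by
    funext w
    rw [Finset.sum_apply, ← map_sum]
    congr 1
    exact (LinearMap.sum_single_apply (fun _ => W') (F w)).symm
  rw [h]
  exact sum_mem fun k _ => hF k (φ.comp (LinearMap.single ℂ (fun _ => W') k))

theorem isPolyMap_of_mem_polyFun {f : W → ℂ} (hf : f ∈ polyFun W) : IsPolyMap f := fun φ => by
  have h : (fun w => φ (f w)) = fun w => f w * φ 1 := by
    funext w
    rw [← smul_eq_mul, ← map_smul, smul_eq_mul, mul_one]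
  rw [h]
  exact mul_mem hf (const_mem_polyFun _)

/-- A linear embedding has a linear left inverse, so every linear form on the source factors through
it. This reduces traceless matrices to matrix entries. -/
theorem IsPolyMap.of_injective {W'' : Type} [AddCommGroup W''] [Module ℂ W''] {F : W → W'}
    (a : W' →ₗ[ℂ] W'') (ha : Function.Injective a) (hF : IsPolyMap fun w => a (F w)) :
    IsPolyMap F := fun φ => by
  obtain ⟨b, hb⟩ := a.exists_leftInverse_of_injective (LinearMap.ker_eq_bot.2 ha)
  have h : ∀ w, φ (F w) = φ.comp b (a (F w)) := fun w => by
    rw [LinearMap.comp_apply, ← LinearMap.comp_apply b a, hb, LinearMap.id_apply]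
  simp only [h]
  exact hF (φ.comp b)

/-- Each linear form contributes one denominator `δ`; sums and products only need a larger power. -/
theorem polyFun_comp_inv_smul {δ : W → ℂ} (hδ : δ ∈ polyFun W) {R : W → W'} (hR : IsPolyMap R)
    {f : W' → ℂ} (hf : f ∈ polyFun W') :
    ∃ N : ℕ, ∃ p ∈ polyFun W, ∀ w, δ w ≠ 0 → f ((δ w)⁻¹ • R w) = p w / δ w ^ N := by
  induction hf using Algebra.adjoin_induction with
  | mem f hf =>
    obtain ⟨φ, rfl⟩ := hf
    refine ⟨1, _, hR φ, fun w hw => ?_⟩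
    simp only [map_smul, smul_eq_mul, pow_one]
    rw [inv_mul_eq_div]
  | algebraMap c => exact ⟨0, _, const_mem_polyFun c, fun w _ => by simp⟩
  | add f g _ _ h1 h2 =>
    obtain ⟨N, p, hp, h1⟩ := h1
    obtain ⟨M, q, hq, h2⟩ := h2
    refine ⟨N + M, _, add_mem (mul_mem hp (pow_mem hδ M)) (mul_mem (pow_mem hδ N) hq),
      fun w hw => ?_⟩
    rw [Pi.add_apply, h1 w hw, h2 w hw, div_add_div _ _ (pow_ne_zero _ hw) (pow_ne_zero _ hw),
      pow_add]
    rfl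
  | mul f g _ _ h1 h2 =>
    obtain ⟨N, p, hp, h1⟩ := h1
    obtain ⟨M, q, hq, h2⟩ := h2
    refine ⟨N + M, _, mul_mem hp hq, fun w hw => ?_⟩
    rw [Pi.mul_apply, h1 w hw, h2 w hw, div_mul_div_comm, pow_add]
    rfl

open FunctionSpace

/-- A rational map is a morphism where its denominator does not vanish. -/
theorem morAt_inv_smul {δ : W → ℂ} (hδ : δ ∈ polyFun W) {R : W → W'} (hR : IsPolyMap R) {x : W}
    (hx : δ x ≠ 0) :
    MorAt (affineSpace W) (affineSpace W') (fun w : W => ((δ w)⁻¹ • R w : W')) x := by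
  constructor
  · let _ := zariskiTopology W
    let _ := zariskiTopology W'
    intro V hV
    obtain ⟨_, ⟨q, hq, rfl⟩, hxq, hqV⟩ := (isTopologicalBasis_zariski W').mem_nhds_iff.1 hV
    obtain ⟨N, p, hp, h⟩ := polyFun_comp_inv_smul hδ hR hq
    refine (isTopologicalBasis_zariski W).mem_nhds_iff.2
      ⟨_, ⟨p * δ, mul_mem hp hδ, rfl⟩, ?_, ?_⟩
    · refine mul_ne_zero (fun h0 => hxq ?_) hx
      rw [h x hx, h0, zero_div]
    · intro y hy
      have hδy : δ y ≠ 0 := right_ne_zero_of_mul hy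
      refine hqV ?_
      show q _ ≠ 0
      rw [h y hδy]
      exact div_ne_zero (left_ne_zero_of_mul hy) (pow_ne_zero _ hδy)
  · rintro k ⟨p, hp, q, hq, hxq, hk⟩
    obtain ⟨N, p', hp', h1⟩ := polyFun_comp_inv_smul hδ hR hp
    obtain ⟨M, q', hq', h2⟩ := polyFun_comp_inv_smul hδ hR hq
    -- The quotient is `p' δ ^ M / (q' δ ^ N)`. The extra factor `δ` makes a nonzero denominator
    -- force `δ y ≠ 0` even for `N = 0`.
    refine ⟨p' * δ ^ (M + 1), mul_mem hp' (pow_mem hδ _), q' * δ ^ (N + 1),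
      mul_mem hq' (pow_mem hδ _), ?_, fun y hy => ?_⟩
    · refine mul_ne_zero (fun h0 => hxq ?_) (pow_ne_zero _ hx)
      show q ((δ x)⁻¹ • R x) = 0
      rw [h2 x hx, h0, zero_div]
    · have hδy : δ y ≠ 0 := ne_zero_pow (Nat.succ_ne_zero N) (right_ne_zero_of_mul hy)
      have hqy : q' y ≠ 0 := left_ne_zero_of_mul hy
      have hq0 : q ((δ y)⁻¹ • R y) ≠ 0 := by
        rw [h2 y hδy]; exact div_ne_zero hqy (pow_ne_zero _ hδy)
      show k ((δ y)⁻¹ • R y) = (p' y * δ y ^ (M + 1)) / (q' y * δ y ^ (N + 1))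
      rw [hk _ hq0, h1 y hδy, h2 y hδy]
      field_simp
      ring

theorem IsPolyMap.isMor {R : W → W'} (hR : IsPolyMap R) :
    IsMor (affineSpace W) (affineSpace W') R := fun x => by
  have h := morAt_inv_smul (const_mem_polyFun 1) hR (x := x) one_ne_zero
  simpa using h

/-- A polynomial function that vanishes on a set vanishes on its closure. -/
theorem polyFun_eq_zero_of_mem_closure {S : Set W} {T : Set ((affineSpace W).induced S).carrier}
    {z : ((affineSpace W).induced S).carrier} (hz : z ∈ closure T) {f : W → ℂ} (hf : f ∈ polyFun W)
    (h0 : ∀ y ∈ T, f y.1 = 0) : f z.1 = 0 := by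
  by_contra hne
  have ho : IsOpen {y : ((affineSpace W).induced S).carrier | f y.1 ≠ 0} := by
    let _ := zariskiTopology W
    exact IsOpen.preimage continuous_subtype_val
      ((isTopologicalBasis_zariski W).isOpen ⟨f, hf, rfl⟩)
  obtain ⟨y, hy, hyT⟩ := mem_closure_iff.1 hz _ ho hne
  exact hy (h0 y hyT)

/-- A polynomial function whose restriction to a punctured line has a pole vanishes. -/
theorem eq_zero_of_pow_mul_line {f : W → ℂ} (hf : f ∈ polyFun W) (y₀ y₁ : W) {m : ℕ} (hm : 0 < m)
    {c : ℂ} (h : ∀ s : ℂ, s ≠ 0 → s ^ m * f (y₀ + s • y₁) = c) : c = 0 := by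
  -- Continuity is meant in the usual topology of `ℂ`; the conclusion is the limit `s → 0`.
  have hc : Continuous fun s : ℂ => f (y₀ + s • y₁) := by
    clear h
    induction hf using Algebra.adjoin_induction with
    | mem f hf =>
      obtain ⟨φ, rfl⟩ := hf
      simp only [map_add, map_smul, smul_eq_mul]
      fun_prop
    | algebraMap c => exact continuous_const
    | add f g _ _ h1 h2 => exact h1.add h2
    | mul f g _ _ h1 h2 => exact h1.mul h2
  have hc' : Continuous fun s : ℂ => s ^ m * f (y₀ + s • y₁) := (continuous_pow m).mul hc
  have h1 : Filter.Tendsto (fun s : ℂ => s ^ m * f (y₀ + s • y₁)) (𝓝[≠] 0) (𝓝 0) := by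
    have := hc'.tendsto 0
    simp only [zero_pow hm.ne', zero_mul] at this
    exact this.mono_left nhdsWithin_le_nhds
  have h2 : Filter.Tendsto (fun s : ℂ => s ^ m * f (y₀ + s • y₁)) (𝓝[≠] 0) (𝓝 c) := by
    refine tendsto_const_nhds.congr' ?_
    filter_upwards [self_mem_nhdsWithin] with s hs using (h s hs).symm
  exact tendsto_nhds_unique h2 h1

end Polynomial

noncomputable section

open LieAlgebra.SpecialLinear FunctionSpace

/-! ### Loops of a representation and the action of `GL₂` -/

section Loops

variable {ℓ : ℕ}

/-- The inclusion of the traceless matrices. -/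
def slVal : sl (Fin 2) ℂ →ₗ[ℂ] Matrix (Fin 2) (Fin 2) ℂ where
  toFun B := B.1
  map_add' _ _ := rfl
  map_smul' _ _ := rfl

/-- The loops of a representation, indexed by the doubled set of loops. -/
def loopSl (A : Fin ℓ ⊕ Fin ℓ) : QuiverRep 2 ℓ →ₗ[ℂ] sl (Fin 2) ℂ :=
  A.elim (fun k => LinearMap.proj k ∘ₗ LinearMap.fst ℂ _ _)
    (fun k => LinearMap.proj k ∘ₗ LinearMap.fst ℂ _ _ ∘ₗ LinearMap.snd ℂ _ _)

/-- The loops as matrices. -/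
def loopMat (A : Fin ℓ ⊕ Fin ℓ) (x : QuiverRep 2 ℓ) : Matrix (Fin 2) (Fin 2) ℂ := (loopSl A x).1

/-- The representation with given loops, covector and vector. -/
def mkRep (B : Fin ℓ ⊕ Fin ℓ → sl (Fin 2) ℂ) (i j : Fin 2 → ℂ) : QuiverRep 2 ℓ :=
  (fun k => B (.inl k), fun k => B (.inr k), i, j)

@[simp] theorem loopMat_mkRep (A : Fin ℓ ⊕ Fin ℓ) (B : Fin ℓ ⊕ Fin ℓ → sl (Fin 2) ℂ)
    (i j : Fin 2 → ℂ) : loopMat A (mkRep B i j) = (B A).1 := by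
  cases A <;> rfl

@[simp] theorem loopMat_add (A : Fin ℓ ⊕ Fin ℓ) (x y : QuiverRep 2 ℓ) :
    loopMat A (x + y) = loopMat A x + loopMat A y := by
  simp [loopMat]

@[simp] theorem loopMat_smul (A : Fin ℓ ⊕ Fin ℓ) (c : ℂ) (x : QuiverRep 2 ℓ) :
    loopMat A (c • x) = c • loopMat A x := by
  simp [loopMat]

theorem quiverRep_ext {x y : QuiverRep 2 ℓ} (h : ∀ A, loopMat A x = loopMat A y)
    (hi : x.2.2.1 = y.2.2.1) (hj : x.2.2.2 = y.2.2.2) : x = y :=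
  Prod.ext (funext fun k => Subtype.ext (h (.inl k)))
    (Prod.ext (funext fun k => Subtype.ext (h (.inr k))) (Prod.ext hi hj))

theorem sl_apply_one_one (B : sl (Fin 2) ℂ) : B.1 1 1 = -B.1 0 0 := by
  have h : Matrix.trace B.1 = 0 := B.2
  rw [Matrix.trace_fin_two] at h
  linear_combination h

theorem loopMat_one_one (A : Fin ℓ ⊕ Fin ℓ) (x : QuiverRep 2 ℓ) :
    loopMat A x 1 1 = -loopMat A x 0 0 := sl_apply_one_one _

@[simp] theorem loopMat_glRep (A : Fin ℓ ⊕ Fin ℓ) (g : GL (Fin 2) ℂ) (x : QuiverRep 2 ℓ) :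
    loopMat A (glRep 2 ℓ g x) = g.1 * loopMat A x * (g⁻¹).1 := by
  cases A <;> rfl

theorem glRep_covector (g : GL (Fin 2) ℂ) (x : QuiverRep 2 ℓ) :
    (glRep 2 ℓ g x).2.2.1 = Matrix.vecMul x.2.2.1 (g⁻¹).1 := rfl

theorem glRep_vector (g : GL (Fin 2) ℂ) (x : QuiverRep 2 ℓ) :
    (glRep 2 ℓ g x).2.2.2 = Matrix.mulVec g.1 x.2.2.2 := rfl

theorem momentMap_glRep (g : GL (Fin 2) ℂ) (x : QuiverRep 2 ℓ) :
    momentMap 2 ℓ (glRep 2 ℓ g x) = g.1 * momentMap 2 ℓ x * (g⁻¹).1 := by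
  have h : ∀ B C : Matrix (Fin 2) (Fin 2) ℂ,
      g.1 * B * (g⁻¹).1 * (g.1 * C * (g⁻¹).1) = g.1 * (B * C) * (g⁻¹).1 := fun B C => by
    have : (g⁻¹).1 * g.1 = 1 := Units.inv_mul g
    calc _ = g.1 * B * ((g⁻¹).1 * g.1) * C * (g⁻¹).1 := by simp only [mul_assoc]
      _ = _ := by rw [this]; simp only [mul_assoc, mul_one]
  have h1 : ∀ k, ((glRep 2 ℓ g x).1 k).1 = g.1 * (x.1 k).1 * (g⁻¹).1 := fun _ => rfl
  have h2 : ∀ k, ((glRep 2 ℓ g x).2.1 k).1 = g.1 * (x.2.1 k).1 * (g⁻¹).1 := fun _ => rfl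
  simp only [momentMap, h1, h2, h, glRep_covector, glRep_vector]
  rw [mul_sub, sub_mul, Matrix.mul_vecMulVec, Matrix.vecMulVec_mul, Finset.mul_sum, Finset.sum_mul]
  simp only [mul_sub, sub_mul]

theorem glRep_mem_momentZero (g : GL (Fin 2) ℂ) {x : QuiverRep 2 ℓ} (hx : x ∈ momentZero 2 ℓ) :
    glRep 2 ℓ g x ∈ momentZero 2 ℓ := by
  have h : momentMap 2 ℓ x = 0 := hx
  show momentMap 2 ℓ _ = 0
  rw [momentMap_glRep, h, mul_zero, zero_mul]

theorem isPolyMap_loopMat (A : Fin ℓ ⊕ Fin ℓ) : IsPolyMap (loopMat A) :=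
  (slVal ∘ₗ loopSl A).isPolyMap

end Loops

/-! ### Matrix operations on polynomial maps -/

section PolyMatrix

variable {W : Type} [AddCommGroup W] [Module ℂ W]

theorem isPolyMap_matrix_iff {M : W → Matrix (Fin 2) (Fin 2) ℂ} :
    IsPolyMap M ↔ ∀ a b, (fun w => M w a b) ∈ polyFun W :=
  ⟨fun h a b => h (LinearMap.proj b ∘ₗ LinearMap.proj a),
    fun h => IsPolyMap.pi fun a => IsPolyMap.pi fun b => isPolyMap_of_mem_polyFun (h a b)⟩

theorem isPolyMap_vec_iff {v : W → Fin 2 → ℂ} :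
    IsPolyMap v ↔ ∀ a, (fun w => v w a) ∈ polyFun W :=
  ⟨fun h a => h (LinearMap.proj a), fun h => IsPolyMap.pi fun a => isPolyMap_of_mem_polyFun (h a)⟩

theorem IsPolyMap.matrix_mul {M N : W → Matrix (Fin 2) (Fin 2) ℂ} (hM : IsPolyMap M)
    (hN : IsPolyMap N) : IsPolyMap fun w => M w * N w := by
  rw [isPolyMap_matrix_iff] at *
  intro a b
  simp only [Matrix.mul_apply, Fin.sum_univ_two]
  exact add_mem (mul_mem (hM a 0) (hN 0 b)) (mul_mem (hM a 1) (hN 1 b))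

theorem IsPolyMap.mulVec {M : W → Matrix (Fin 2) (Fin 2) ℂ} {v : W → Fin 2 → ℂ} (hM : IsPolyMap M)
    (hv : IsPolyMap v) : IsPolyMap fun w => Matrix.mulVec (M w) (v w) := by
  rw [isPolyMap_matrix_iff] at hM
  rw [isPolyMap_vec_iff] at *
  intro a
  simp only [Matrix.mulVec, dotProduct, Fin.sum_univ_two]
  exact add_mem (mul_mem (hM a 0) (hv 0)) (mul_mem (hM a 1) (hv 1))

theorem IsPolyMap.vecMul {M : W → Matrix (Fin 2) (Fin 2) ℂ} {v : W → Fin 2 → ℂ} (hM : IsPolyMap M)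
    (hv : IsPolyMap v) : IsPolyMap fun w => Matrix.vecMul (v w) (M w) := by
  rw [isPolyMap_matrix_iff] at hM
  rw [isPolyMap_vec_iff] at *
  intro a
  simp only [Matrix.vecMul, dotProduct, Fin.sum_univ_two]
  exact add_mem (mul_mem (hv 0) (hM 0 a)) (mul_mem (hv 1) (hM 1 a))

theorem IsPolyMap.det {M : W → Matrix (Fin 2) (Fin 2) ℂ} (hM : IsPolyMap M) :
    (fun w => (M w).det) ∈ polyFun W := by
  rw [isPolyMap_matrix_iff] at hM
  simp only [Matrix.det_fin_two]
  exact sub_mem (mul_mem (hM 0 0) (hM 1 1)) (mul_mem (hM 0 1) (hM 1 0))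

theorem IsPolyMap.adjugate {M : W → Matrix (Fin 2) (Fin 2) ℂ} (hM : IsPolyMap M) :
    IsPolyMap fun w => (M w).adjugate := by
  rw [isPolyMap_matrix_iff] at *
  intro a b
  simp only [Matrix.adjugate_fin_two]
  fin_cases a <;> fin_cases b
  · exact hM 1 1
  · exact neg_mem (hM 0 1)
  · exact neg_mem (hM 1 0)
  · exact hM 0 0

end PolyMatrix

/-! ### Frames `(j, A j)` and normal forms -/

section Frame

variable {ℓ : ℕ}

/-- The matrix with columns `j` and `A j`. -/
def frame (A : Fin ℓ ⊕ Fin ℓ) (x : QuiverRep 2 ℓ) : Matrix (Fin 2) (Fin 2) ℂ :=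
  !![x.2.2.2 0, Matrix.mulVec (loopMat A x) x.2.2.2 0;
    x.2.2.2 1, Matrix.mulVec (loopMat A x) x.2.2.2 1]

/-- Since `(g A g⁻¹) (g j) = g (A j)`, the group acts on frames by left multiplication, hence freely
where the frame is invertible. -/
theorem frame_glRep (A : Fin ℓ ⊕ Fin ℓ) (g : GL (Fin 2) ℂ) (x : QuiverRep 2 ℓ) :
    frame A (glRep 2 ℓ g x) = g.1 * frame A x := by
  have h : (g⁻¹).1 * g.1 = 1 := Units.inv_mul g
  have h2 : Matrix.mulVec (loopMat A (glRep 2 ℓ g x)) (Matrix.mulVec g.1 x.2.2.2) =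
      Matrix.mulVec g.1 (Matrix.mulVec (loopMat A x) x.2.2.2) := by
    rw [loopMat_glRep, Matrix.mulVec_mulVec, Matrix.mulVec_mulVec, mul_assoc, h, mul_one]
  simp only [frame, glRep_vector, h2]
  ext a b
  fin_cases a <;> fin_cases b <;> simp [Matrix.mul_apply, Matrix.mulVec, dotProduct]

theorem isPolyMap_vector : IsPolyMap fun x : QuiverRep 2 ℓ => x.2.2.2 :=
  (LinearMap.snd ℂ _ _ ∘ₗ LinearMap.snd ℂ _ _ ∘ₗ LinearMap.snd ℂ _ _ :
    QuiverRep 2 ℓ →ₗ[ℂ] (Fin 2 → ℂ)).isPolyMap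

theorem isPolyMap_covector : IsPolyMap fun x : QuiverRep 2 ℓ => x.2.2.1 :=
  (LinearMap.fst ℂ _ _ ∘ₗ LinearMap.snd ℂ _ _ ∘ₗ LinearMap.snd ℂ _ _ :
    QuiverRep 2 ℓ →ₗ[ℂ] (Fin 2 → ℂ)).isPolyMap

theorem isPolyMap_frame (A : Fin ℓ ⊕ Fin ℓ) : IsPolyMap (frame A) := by
  rw [isPolyMap_matrix_iff]
  have h1 := isPolyMap_vec_iff.1 (isPolyMap_vector (ℓ := ℓ))
  have h2 := isPolyMap_vec_iff.1 ((isPolyMap_loopMat A).mulVec isPolyMap_vector)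
  intro a b
  fin_cases a <;> fin_cases b
  · exact h1 0
  · exact h2 0
  · exact h1 1
  · exact h2 1

/-- `B ↦ adj(M) B M` on traceless matrices. -/
def adjConj (M : Matrix (Fin 2) (Fin 2) ℂ) (B : sl (Fin 2) ℂ) : sl (Fin 2) ℂ :=
  ⟨M.adjugate * B.1 * M, by
    have h : Matrix.trace B.1 = 0 := B.2
    show Matrix.trace (M.adjugate * B.1 * M) = 0
    rw [Matrix.trace_mul_comm, ← mul_assoc, Matrix.mul_adjugate]
    simp [h]⟩

/-- The numerator of the normal form with respect to the frame `(j, A j)`. -/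
def normalNum (A : Fin ℓ ⊕ Fin ℓ) (x : QuiverRep 2 ℓ) : QuiverRep 2 ℓ :=
  (fun k => adjConj (frame A x) (x.1 k), fun k => adjConj (frame A x) (x.2.1 k),
    -- The covector `i M` of the normal form has no denominator; the factor `det M` compensates for
    -- the common one.
    (frame A x).det • Matrix.vecMul x.2.2.1 (frame A x),
    Matrix.mulVec (frame A x).adjugate x.2.2.2)

/-- The normal form with respect to the frame `(j, A j)`, where this is a basis. -/
def normalForm (A : Fin ℓ ⊕ Fin ℓ) (x : QuiverRep 2 ℓ) : QuiverRep 2 ℓ :=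
  ((frame A x).det)⁻¹ • normalNum A x

theorem isPolyMap_normalNum (A : Fin ℓ ⊕ Fin ℓ) : IsPolyMap (normalNum A) := by
  have hf := isPolyMap_frame A
  have h : ∀ B : Fin ℓ ⊕ Fin ℓ, IsPolyMap fun x => adjConj (frame A x) (loopSl B x) := fun B =>
    IsPolyMap.of_injective slVal Subtype.val_injective
      ((hf.adjugate.matrix_mul (isPolyMap_loopMat B)).matrix_mul hf)
  exact (IsPolyMap.pi fun k => h (.inl k)).prodMk ((IsPolyMap.pi fun k => h (.inr k)).prodMk
    ((IsPolyMap.smul hf.det (hf.vecMul isPolyMap_covector)).prodMk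
      (hf.adjugate.mulVec isPolyMap_vector)))

/-- By Cramer's rule `adj(M) / det M` is the inverse of the frame `M`, so the rational expression is
a translate of `x`. -/
theorem normalForm_eq {A : Fin ℓ ⊕ Fin ℓ} {x : QuiverRep 2 ℓ} (u : GL (Fin 2) ℂ)
    (hu : u.1 = frame A x) : normalForm A x = glRep 2 ℓ u⁻¹ x := by
  have hdet : (frame A x).det ≠ 0 := by
    rw [← hu]; exact ((Matrix.isUnit_iff_isUnit_det _).1 u.isUnit).ne_zero
  have hinv : (u⁻¹).1 = ((frame A x).det)⁻¹ • (frame A x).adjugate := by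
    rw [Matrix.coe_units_inv, hu, Matrix.inv_def, Ring.inverse_eq_inv']
  refine quiverRep_ext (fun B => ?_) ?_ ?_
  · rw [loopMat_glRep, inv_inv, hu, hinv, normalForm, loopMat_smul]
    have : loopMat B (normalNum A x) = (frame A x).adjugate * loopMat B x * frame A x := by
      cases B <;> rfl
    rw [this, Matrix.smul_mul, Matrix.smul_mul]
  · rw [glRep_covector, inv_inv, hu]
    show ((frame A x).det)⁻¹ • ((frame A x).det • Matrix.vecMul x.2.2.1 (frame A x)) = _
    rw [inv_smul_smul₀ hdet]
  · rw [glRep_vector, hinv, Matrix.smul_mulVec]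
    rfl

theorem exists_normalForm_eq {A : Fin ℓ ⊕ Fin ℓ} {x : QuiverRep 2 ℓ} (h : (frame A x).det ≠ 0) :
    ∃ u : GL (Fin 2) ℂ, u.1 = frame A x ∧ normalForm A x = glRep 2 ℓ u⁻¹ x := by
  have hu : (Matrix.GeneralLinearGroup.mkOfDetNeZero _ h).1 = frame A x := rfl
  exact ⟨_, hu, normalForm_eq _ hu⟩

theorem det_frame_glRep (A : Fin ℓ ⊕ Fin ℓ) (g : GL (Fin 2) ℂ) (x : QuiverRep 2 ℓ) :
    (frame A (glRep 2 ℓ g x)).det = g.1.det * (frame A x).det := by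
  rw [frame_glRep, Matrix.det_mul]

theorem det_ne_zero_of_gl (g : GL (Fin 2) ℂ) : g.1.det ≠ 0 :=
  ((Matrix.isUnit_iff_isUnit_det _).1 g.isUnit).ne_zero

theorem det_frame_glRep_eq_zero (A : Fin ℓ ⊕ Fin ℓ) (g : GL (Fin 2) ℂ) (x : QuiverRep 2 ℓ) :
    (frame A (glRep 2 ℓ g x)).det = 0 ↔ (frame A x).det = 0 := by
  rw [det_frame_glRep, mul_eq_zero, or_iff_right (det_ne_zero_of_gl g)]

/-- If `u` is the frame of `x`, that of `g x` is `g u`, and `(g u)⁻¹ g = u⁻¹`. -/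
theorem normalForm_glRep (A : Fin ℓ ⊕ Fin ℓ) (g : GL (Fin 2) ℂ) (x : QuiverRep 2 ℓ) :
    normalForm A (glRep 2 ℓ g x) = normalForm A x := by
  by_cases h : (frame A x).det = 0
  -- For a degenerate frame both sides are zero, by the convention `0⁻¹ = 0`.
  · have h' := (det_frame_glRep_eq_zero A g x).2 h
    rw [normalForm, normalForm, h, h']
    simp
  · obtain ⟨u, hu, hx⟩ := exists_normalForm_eq h
    rw [hx, normalForm_eq (g * u) (by rw [frame_glRep, ← hu]; rfl), ← Module.End.mul_apply,
      ← map_mul]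
    congr 2
    group

theorem frame_normalForm {A : Fin ℓ ⊕ Fin ℓ} {x : QuiverRep 2 ℓ} (h : (frame A x).det ≠ 0) :
    frame A (normalForm A x) = 1 := by
  obtain ⟨u, hu, hx⟩ := exists_normalForm_eq h
  rw [hx, frame_glRep, ← hu]
  exact Units.inv_mul u

theorem normalForm_of_frame_eq_one {A : Fin ℓ ⊕ Fin ℓ} {x : QuiverRep 2 ℓ} (h : frame A x = 1) :
    normalForm A x = x := by
  rw [normalForm_eq 1 h.symm, inv_one, map_one]
  rfl

theorem vector_of_frame_eq_one {A : Fin ℓ ⊕ Fin ℓ} {x : QuiverRep 2 ℓ} (h : frame A x = 1) :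
    x.2.2.2 = ![1, 0] := by
  have h0 := congrFun (congrFun h 0) 0
  have h1 := congrFun (congrFun h 1) 0
  funext a
  fin_cases a
  · simpa [frame] using h0
  · simpa [frame] using h1

theorem frame_eq_one_iff {A : Fin ℓ ⊕ Fin ℓ} {x : QuiverRep 2 ℓ} :
    frame A x = 1 ↔ x.2.2.2 = ![1, 0] ∧ loopMat A x 0 0 = 0 ∧ loopMat A x 1 0 = 1 := by
  constructor
  · intro h
    have hj := vector_of_frame_eq_one h
    have h0 := congrFun (congrFun h 0) 1
    have h1 := congrFun (congrFun h 1) 1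
    simp only [frame, hj] at h0 h1
    exact ⟨hj, by simpa [Matrix.mulVec, dotProduct] using h0,
      by simpa [Matrix.mulVec, dotProduct] using h1⟩
  · rintro ⟨hj, h0, h1⟩
    rw [frame, hj]
    ext a b
    fin_cases a <;> fin_cases b <;> simp [Matrix.mulVec, dotProduct, h0, h1]

end Frame

/-! ### Semistability, orbits and charts of the quotient -/

section Semistable

variable {ℓ : ℕ}

/-- The invertible diagonal matrix `diag(a, b)`. -/
def diagGL (a b : ℂ) (ha : a ≠ 0) (hb : b ≠ 0) : GL (Fin 2) ℂ where
  val := !![a, 0; 0, b]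
  inv := !![a⁻¹, 0; 0, b⁻¹]
  val_inv := by ext r c; fin_cases r <;> fin_cases c <;> simp [ha, hb]
  inv_val := by ext r c; fin_cases r <;> fin_cases c <;> simp [ha, hb]

theorem coe_diagGL (a b : ℂ) (ha : a ≠ 0) (hb : b ≠ 0) :
    (diagGL a b ha hb).1 = !![a, 0; 0, b] := rfl

theorem coe_diagGL_inv (a b : ℂ) (ha : a ≠ 0) (hb : b ≠ 0) :
    ((diagGL a b ha hb)⁻¹).1 = !![a⁻¹, 0; 0, b⁻¹] := rfl

/-- The matrix `diag(c, -c)`. -/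
def diagSl (c : ℂ) : sl (Fin 2) ℂ := ⟨!![c, 0; 0, -c], by
  show Matrix.trace !![c, 0; 0, -c] = 0
  simp [Matrix.trace_fin_two]⟩

/-- The strictly upper triangular matrix with entry `c`. -/
def upperSl (c : ℂ) : sl (Fin 2) ℂ := ⟨!![0, c; 0, 0], by
  show Matrix.trace !![0, c; 0, 0] = 0
  simp [Matrix.trace_fin_two]⟩

/-- The strictly lower triangular matrix with entry `c`. -/
def lowerSl (c : ℂ) : sl (Fin 2) ℂ := ⟨!![0, 0; c, 0], by
  show Matrix.trace !![0, 0; c, 0] = 0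
  simp [Matrix.trace_fin_two]⟩

theorem detInv_pow (g : GL (Fin 2) ℂ) (m : ℕ) :
    ((detInv 2 g : ℂˣ) : ℂ) ^ m = (g.1.det ^ m)⁻¹ := by
  simp [detInv, inv_pow]

theorem exists_glRep_vector {j : Fin 2 → ℂ} (hj : j ≠ 0) :
    ∃ g : GL (Fin 2) ℂ, Matrix.mulVec g.1 j = ![1, 0] := by
  -- It suffices to complete `j` to a basis, used as the columns of `u`.
  have key : ∀ u : GL (Fin 2) ℂ, Matrix.mulVec u.1 ![1, 0] = j →
      Matrix.mulVec (u⁻¹).1 j = ![1, 0] := fun u hu => by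
    have : (u⁻¹).1 * u.1 = 1 := Units.inv_mul u
    rw [← hu, Matrix.mulVec_mulVec, this, Matrix.one_mulVec]
  by_cases h0 : j 0 = 0
  · have h1 : j 1 ≠ 0 := fun h1 => hj (by funext a; fin_cases a <;> assumption)
    refine ⟨_, key (Matrix.GeneralLinearGroup.mkOfDetNeZero !![0, 1; j 1, 0]
      (by simpa [Matrix.det_fin_two] using h1)) ?_⟩
    funext a
    fin_cases a <;> simp [Matrix.GeneralLinearGroup.mkOfDetNeZero, Matrix.mulVec, dotProduct, h0]
  · refine ⟨_, key (Matrix.GeneralLinearGroup.mkOfDetNeZero !![j 0, 0; j 1, 1]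
      (by simpa [Matrix.det_fin_two] using h0)) ?_⟩
    funext a
    fin_cases a <;> simp [Matrix.GeneralLinearGroup.mkOfDetNeZero, Matrix.mulVec, dotProduct]

/-- The line of `e₁` is stable under the loops, so translating by the inverse of `diag(1, s)`
produces no negative powers of `s`: the orbit moves along an affine line. Semi-invariance gives `s ^
m f = f x` on it, and `s → 0` forces `f x = 0`. -/
theorem semiinvariant_eq_zero_of_vector {f : QuiverRep 2 ℓ → ℂ} (hf : f ∈ polyFun (QuiverRep 2 ℓ))
    {m : ℕ} (hm : 0 < m) {x : QuiverRep 2 ℓ}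
    (hinv : ∀ g : GL (Fin 2) ℂ, f (glRep 2 ℓ g⁻¹ x) = (g.1.det ^ m)⁻¹ * f x)
    (hj : x.2.2.2 = ![1, 0]) (hA : ∀ A, loopMat A x 1 0 = 0) : f x = 0 := by
  refine eq_zero_of_pow_mul_line hf
    (mkRep (fun A => diagSl (loopMat A x 0 0)) ![x.2.2.1 0, 0] ![1, 0])
    (mkRep (fun A => upperSl (loopMat A x 0 1)) ![0, x.2.2.1 1] 0) hm fun s hs => ?_
  have h := hinv (diagGL 1 s one_ne_zero hs)
  have hx : glRep 2 ℓ (diagGL 1 s one_ne_zero hs)⁻¹ x =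
      mkRep (fun A => diagSl (loopMat A x 0 0)) ![x.2.2.1 0, 0] ![1, 0] +
      s • mkRep (fun A => upperSl (loopMat A x 0 1)) ![0, x.2.2.1 1] 0 := by
    refine quiverRep_ext (fun A => ?_) ?_ ?_
    · rw [loopMat_glRep, inv_inv, coe_diagGL, coe_diagGL_inv, loopMat_add, loopMat_smul,
        loopMat_mkRep, loopMat_mkRep]
      ext a b
      simp only [Matrix.mul_apply, Fin.sum_univ_two]
      fin_cases a <;> fin_cases b <;> simp [diagSl, upperSl, hA, loopMat_one_one, hs, mul_comm]
    · rw [glRep_covector, inv_inv, coe_diagGL]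
      funext a
      fin_cases a <;> simp [Matrix.vecMul, dotProduct, mkRep, mul_comm]
    · rw [glRep_vector, coe_diagGL_inv, hj]
      funext a
      fin_cases a <;> simp [Matrix.mulVec, dotProduct, mkRep]
  rw [← hx, h, coe_diagGL]
  simp only [Matrix.det_fin_two_of, one_mul, mul_zero, sub_zero]
  rw [mul_inv_cancel_left₀ (pow_ne_zero _ hs)]

/-- For `j = 0` the scalar matrices destabilise: they fix the loops and scale only `i`. The
determinant `s ^ 2` accounts for the exponent `2 m`. -/
theorem semiinvariant_eq_zero_of_vector_eq_zero {f : QuiverRep 2 ℓ → ℂ}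
    (hf : f ∈ polyFun (QuiverRep 2 ℓ)) {m : ℕ} (hm : 0 < m) {x : QuiverRep 2 ℓ}
    (hinv : ∀ g : GL (Fin 2) ℂ, f (glRep 2 ℓ g⁻¹ x) = (g.1.det ^ m)⁻¹ * f x)
    (hj : x.2.2.2 = 0) : f x = 0 := by
  refine eq_zero_of_pow_mul_line hf (mkRep (fun A => loopSl A x) 0 0) (mkRep 0 x.2.2.1 0)
    (Nat.mul_pos two_pos hm) fun s hs => ?_
  have h := hinv (diagGL s s hs hs)
  have hx : glRep 2 ℓ (diagGL s s hs hs)⁻¹ x =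
      mkRep (fun A => loopSl A x) 0 0 + s • mkRep 0 x.2.2.1 0 := by
    refine quiverRep_ext (fun A => ?_) ?_ ?_
    · rw [loopMat_glRep, inv_inv, coe_diagGL, coe_diagGL_inv, loopMat_add, loopMat_smul,
        loopMat_mkRep, loopMat_mkRep]
      ext a b
      simp only [Matrix.mul_apply, Fin.sum_univ_two]
      fin_cases a <;> fin_cases b <;> simp [hs, loopMat, mul_comm]
    · rw [glRep_covector, inv_inv, coe_diagGL]
      funext a
      fin_cases a <;> simp [Matrix.vecMul, dotProduct, mkRep, mul_comm]
    · rw [glRep_vector, hj]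
      simp [mkRep]
  rw [← hx, h, coe_diagGL]
  simp only [Matrix.det_fin_two_of, mul_zero, sub_zero]
  rw [← sq, ← pow_mul, mul_inv_cancel_left₀ (pow_ne_zero _ hs)]

/-- The determinant of a frame is itself a semi-invariant, with `m = 1`. Conversely, if all frames
are degenerate, then `j = 0` or the line of `j` is stable, and every semi-invariant vanishes. -/
theorem mem_semistable_iff {x : QuiverRep 2 ℓ} :
    x ∈ semistable (glRep 2 ℓ) (detInv 2) (momentZero 2 ℓ) ↔
      x ∈ momentZero 2 ℓ ∧ ∃ A, (frame A x).det ≠ 0 := by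
  constructor
  · rintro ⟨hx, m, hm, f, hf, hinv, hfx⟩
    refine ⟨hx, ?_⟩
    by_contra! hA
    have hinv' : ∀ (h g : GL (Fin 2) ℂ), f (glRep 2 ℓ g⁻¹ (glRep 2 ℓ h x)) =
        (g.1.det ^ m)⁻¹ * f (glRep 2 ℓ h x) := fun h g => by
      rw [hinv g _ (glRep_mem_momentZero h hx), detInv_pow]
    by_cases hj : x.2.2.2 = 0
    · refine hfx (semiinvariant_eq_zero_of_vector_eq_zero hf hm (fun g => ?_) hj)
      have := hinv' 1 g
      rwa [map_one, Module.End.one_apply] at this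
    · obtain ⟨g, hg⟩ := exists_glRep_vector hj
      have h0 : f (glRep 2 ℓ g x) = 0 := by
        refine semiinvariant_eq_zero_of_vector hf hm (hinv' g) hg fun A => ?_
        -- Once `j = e₁`, the determinant of the frame is the lower left entry of the loop.
        have h1 := (det_frame_glRep_eq_zero A g x).2 (hA A)
        rw [frame, glRep_vector, hg] at h1
        simpa [Matrix.det_fin_two, Matrix.mulVec, dotProduct] using h1
      have h1 := hinv g⁻¹ x hx
      rw [inv_inv, h0, detInv_pow] at h1
      exact mul_ne_zero (inv_ne_zero (pow_ne_zero m (det_ne_zero_of_gl g⁻¹))) hfx h1.symm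
  · rintro ⟨hx, A, hA⟩
    refine ⟨hx, 1, one_pos, fun x => (frame A x).det, (isPolyMap_frame A).det, fun g z _ => ?_, hA⟩
    beta_reduce
    rw [detInv_pow, pow_one, det_frame_glRep, Matrix.coe_units_inv, Matrix.det_nonsing_inv,
      Ring.inverse_eq_inv']

variable (ℓ) in
/-- The semistable locus. -/
abbrev SemistableRep : FunctionSpace :=
  semistableSpace (glRep 2 ℓ) (detInv 2) (momentZero 2 ℓ)

/-- The representation underlying a point of the semistable locus. -/
def toRep (x : (SemistableRep ℓ).carrier) : QuiverRep 2 ℓ := x.1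

theorem toRep_mem (x : (SemistableRep ℓ).carrier) :
    toRep x ∈ semistable (glRep 2 ℓ) (detInv 2) (momentZero 2 ℓ) := x.2

theorem isMor_toRep : IsMor (SemistableRep ℓ) (affineSpace (QuiverRep 2 ℓ)) toRep := isMor_val _

/-- The point of the semistable locus defined by a semistable representation. -/
def ofRep (x : QuiverRep 2 ℓ) (hx : x ∈ semistable (glRep 2 ℓ) (detInv 2) (momentZero 2 ℓ)) :
    (SemistableRep ℓ).carrier := ⟨x, hx⟩

@[simp] theorem toRep_ofRep (x : QuiverRep 2 ℓ)
    (hx : x ∈ semistable (glRep 2 ℓ) (detInv 2) (momentZero 2 ℓ)) : toRep (ofRep x hx) = x := rfl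

theorem morAt_of_toRep {X : FunctionSpace} {f : X.carrier → (SemistableRep ℓ).carrier}
    {x : X.carrier} (hf : MorAt X (affineSpace (QuiverRep 2 ℓ)) (fun z => toRep (f z)) x) :
    MorAt X (SemistableRep ℓ) f x := MorAt.codRestrict hf

theorem polyFun_toRep_eq_zero {T : Set (SemistableRep ℓ).carrier} {z : (SemistableRep ℓ).carrier}
    (hz : z ∈ closure T) {f : QuiverRep 2 ℓ → ℂ} (hf : f ∈ polyFun (QuiverRep 2 ℓ))
    (h0 : ∀ y ∈ T, f (toRep y) = 0) : f (toRep z) = 0 :=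
  polyFun_eq_zero_of_mem_closure hz hf h0

theorem isOpen_toRep_ne_zero {f : QuiverRep 2 ℓ → ℂ} (hf : f ∈ polyFun (QuiverRep 2 ℓ)) :
    IsOpen {x : (SemistableRep ℓ).carrier | f (toRep x) ≠ 0} := by
  let _ := zariskiTopology (QuiverRep 2 ℓ)
  exact IsOpen.preimage continuous_subtype_val
    ((isTopologicalBasis_zariski (QuiverRep 2 ℓ)).isOpen ⟨_, hf, rfl⟩)

theorem mem_semistableOrbit {x y : (SemistableRep ℓ).carrier} :
    y ∈ semistableOrbit (glRep 2 ℓ) (detInv 2) (momentZero 2 ℓ) x ↔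
      ∃ g, toRep y = glRep 2 ℓ g (toRep x) := Iff.rfl

theorem glRep_mem_semistable (g : GL (Fin 2) ℂ) {x : QuiverRep 2 ℓ}
    (hx : x ∈ semistable (glRep 2 ℓ) (detInv 2) (momentZero 2 ℓ)) :
    glRep 2 ℓ g x ∈ semistable (glRep 2 ℓ) (detInv 2) (momentZero 2 ℓ) := by
  rw [mem_semistable_iff] at *
  obtain ⟨h, A, hA⟩ := hx
  exact ⟨glRep_mem_momentZero g h, A, fun h0 => hA ((det_frame_glRep_eq_zero A g x).1 h0)⟩

/-- Vanishing of the frame determinant and having a prescribed normal form, with the denominator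
cleared, are polynomial conditions, so they pass from an orbit to its closure. -/
theorem normalForm_of_mem_closure {x z : (SemistableRep ℓ).carrier}
    (hz : z ∈ closure (semistableOrbit (glRep 2 ℓ) (detInv 2) (momentZero 2 ℓ) x)) {A : Fin ℓ ⊕ Fin ℓ} (hA : (frame A (toRep z)).det ≠ 0) :
    (frame A (toRep x)).det ≠ 0 ∧ normalForm A (toRep z) = normalForm A (toRep x) := by
  have hx : (frame A (toRep x)).det ≠ 0 := fun h0 => hA <| by
    refine polyFun_toRep_eq_zero hz (isPolyMap_frame A).det ?_
    intro y hy'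
    obtain ⟨g, hg⟩ := mem_semistableOrbit.1 hy'
    rw [hg, det_frame_glRep_eq_zero, h0]
  refine ⟨hx, ?_⟩
  -- Linear forms turn the equality of vectors into scalar polynomial equations.
  rw [← sub_eq_zero, ← Module.forall_dual_apply_eq_zero_iff ℂ]
  intro φ
  have h := polyFun_toRep_eq_zero hz
    (f := fun w => φ (normalNum A w) - φ (normalForm A (toRep x)) * (frame A w).det)
    (sub_mem (isPolyMap_normalNum A φ)
      (mul_mem (const_mem_polyFun (φ (normalForm A (toRep x)))) (isPolyMap_frame A).det)) ?_
  · rw [map_sub, normalForm, map_smul, smul_eq_mul, inv_mul_eq_div, sub_eq_zero, div_eq_iff hA]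
    exact sub_eq_zero.1 h
  · intro y hy'
    obtain ⟨g, hg⟩ := mem_semistableOrbit.1 hy'
    have hy : (frame A (toRep y)).det ≠ 0 := by
      rw [hg]; exact fun h0 => hx ((det_frame_glRep_eq_zero A g (toRep x)).1 h0)
    have hxy : normalForm A (toRep x) = normalForm A (toRep y) := by rw [hg, normalForm_glRep]
    rw [hxy, normalForm, map_smul, smul_eq_mul, inv_mul_eq_div, div_mul_cancel₀ _ hy, sub_self]

/-- A common point of the two closures has an invertible frame `A`; both points then share its
normal form for `A`, hence lie in one orbit. -/
theorem orbitClosuresMeet_iff {x y : (SemistableRep ℓ).carrier} :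
    orbitClosuresMeet (glRep 2 ℓ) (detInv 2) (momentZero 2 ℓ) x y ↔
      ∃ g, (toRep y) = glRep 2 ℓ g (toRep x) := by
  constructor
  · rintro ⟨z, hx, hy⟩
    obtain ⟨-, A, hA⟩ := mem_semistable_iff.1 (toRep_mem z)
    obtain ⟨hx, hzx⟩ := normalForm_of_mem_closure hx hA
    obtain ⟨hy, hzy⟩ := normalForm_of_mem_closure hy hA
    obtain ⟨u, -, hu⟩ := exists_normalForm_eq hx
    obtain ⟨v, -, hv⟩ := exists_normalForm_eq hy
    refine ⟨v * u⁻¹, ?_⟩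
    rw [map_mul, Module.End.mul_apply, ← hu, ← hzx, hzy, hv, ← Module.End.mul_apply, ← map_mul,
      mul_inv_cancel, map_one, Module.End.one_apply]
  · rintro ⟨g, hg⟩
    exact ⟨y, subset_closure ⟨g, hg⟩, subset_closure ⟨1, by rw [map_one]; rfl⟩⟩

/-- The point of the quiver variety defined by a semistable representation. -/
def toVariety (x : (SemistableRep ℓ).carrier) : (quiverVariety 2 ℓ).carrier := Quot.mk _ x

theorem isMor_toVariety : IsMor (SemistableRep ℓ) (quiverVariety 2 ℓ) toVariety := isMor_mk _

theorem toVariety_surjective (p : (quiverVariety 2 ℓ).carrier) : ∃ x, toVariety x = p :=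
  Quot.exists_rep p

/-- Equality in `Quot` is the generated equivalence relation; being the orbit relation, the given
one is already an equivalence. -/
theorem toVariety_eq_iff {x y : (SemistableRep ℓ).carrier} :
    toVariety x = toVariety y ↔ ∃ g, (toRep y) = glRep 2 ℓ g (toRep x) := by
  constructor
  · intro h
    refine orbitClosuresMeet_iff.1 ((Equivalence.quot_mk_eq_iff ⟨?_, ?_, ?_⟩ x y).1 h)
    · exact fun a => orbitClosuresMeet_iff.2 ⟨1, by rw [map_one]; rfl⟩
    · rintro a b ⟨z, h1, h2⟩
      exact ⟨z, h2, h1⟩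
    · intro a b c hab hbc
      obtain ⟨g, hg⟩ := orbitClosuresMeet_iff.1 hab
      obtain ⟨h, hh⟩ := orbitClosuresMeet_iff.1 hbc
      exact orbitClosuresMeet_iff.2 ⟨h * g, by rw [hh, hg, map_mul]; rfl⟩
  · exact fun h => Quot.sound (orbitClosuresMeet_iff.2 h)

/-- The normal form as a function on the quiver variety. -/
def normalSection (A : Fin ℓ ⊕ Fin ℓ) : (quiverVariety 2 ℓ).carrier → QuiverRep 2 ℓ :=
  Quot.lift (fun x => normalForm A (toRep x)) fun x y h => by
    obtain ⟨g, hg⟩ := orbitClosuresMeet_iff.1 h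
    rw [hg, normalForm_glRep]

/-- The open set where `(j, A j)` is a basis. -/
def frameLocus (A : Fin ℓ ⊕ Fin ℓ) : Set (quiverVariety 2 ℓ).carrier :=
  {p | ∃ x, toVariety x = p ∧ (frame A (toRep x)).det ≠ 0}

theorem toVariety_mem_frameLocus {A : Fin ℓ ⊕ Fin ℓ} {x : (SemistableRep ℓ).carrier} :
    toVariety x ∈ frameLocus A ↔ (frame A (toRep x)).det ≠ 0 := by
  refine ⟨?_, fun h => ⟨x, rfl, h⟩⟩
  rintro ⟨y, hy, h⟩
  obtain ⟨g, hg⟩ := toVariety_eq_iff.1 hy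
  rw [hg]
  exact fun h0 => h ((det_frame_glRep_eq_zero A g (toRep y)).1 h0)

theorem isOpen_frameLocus (A : Fin ℓ ⊕ Fin ℓ) : IsOpen (frameLocus A) := by
  refine isOpen_coinduced.2 ?_
  convert isOpen_toRep_ne_zero (isPolyMap_frame A).det using 1
  exact Set.ext fun x => toVariety_mem_frameLocus

/-- Upstairs the section is a rational map with denominator `det (frame A)`, which has no zeros over
this locus. -/
theorem morAt_normalSection {A : Fin ℓ ⊕ Fin ℓ} {p : (quiverVariety 2 ℓ).carrier}
    (hp : p ∈ frameLocus A) :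
    MorAt (quiverVariety 2 ℓ) (affineSpace (QuiverRep 2 ℓ)) (normalSection A) p := by
  refine morAt_quotient (isOpen_frameLocus A) (fun x hx => ?_) hp
  have h1 := morAt_inv_smul (isPolyMap_frame A).det (isPolyMap_normalNum A)
    (toVariety_mem_frameLocus.1 hx)
  exact h1.comp (isMor_toRep x)

/-- Every point of the frame locus has a representative in normal form. -/
theorem exists_normalForm_rep {A : Fin ℓ ⊕ Fin ℓ} {p : (quiverVariety 2 ℓ).carrier}
    (hp : p ∈ frameLocus A) : ∃ y : (SemistableRep ℓ).carrier,
      toVariety y = p ∧ frame A (toRep y) = 1 ∧ normalSection A p = (toRep y) := by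
  obtain ⟨x, rfl, hx⟩ := hp
  obtain ⟨u, -, hu⟩ := exists_normalForm_eq hx
  exact ⟨ofRep _ (glRep_mem_semistable u⁻¹ (toRep_mem x)), (toVariety_eq_iff.2 ⟨u⁻¹, rfl⟩).symm,
    by rw [← frame_normalForm hx, hu]; rfl, hu⟩

end Semistable

/-! ### Representatives of the three pieces of the fixed locus -/

section Extension

variable {m : ℕ}

/-- The index of `X 0` (for `true`) or `Y 0` (for `false`). -/
def endIdx (b : Bool) : Fin (m + 1) ⊕ Fin (m + 1) := if b then .inl 0 else .inr 0

/-- The index of a loop other than the first pair. -/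
def innerIdx (A : Fin m ⊕ Fin m) : Fin (m + 1) ⊕ Fin (m + 1) := A.map Fin.succ Fin.succ

theorem eq_endIdx_or_innerIdx (A : Fin (m + 1) ⊕ Fin (m + 1)) :
    (∃ b, A = endIdx b) ∨ ∃ B, A = innerIdx B := by
  rcases A with k | k
  · rcases Fin.eq_zero_or_eq_succ k with rfl | ⟨k, rfl⟩
    · exact .inl ⟨true, rfl⟩
    · exact .inr ⟨.inl k, rfl⟩
  · rcases Fin.eq_zero_or_eq_succ k with rfl | ⟨k, rfl⟩
    · exact .inl ⟨false, rfl⟩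
    · exact .inr ⟨.inr k, rfl⟩

/-- A family indexed by the loops, from its values on the first pair and on the others. -/
def extendLoops {S : Type} (e : Bool → S) (B : Fin m ⊕ Fin m → S) :
    Fin (m + 1) ⊕ Fin (m + 1) → S :=
  Sum.elim (Fin.cons (e true) fun k => B (.inl k)) (Fin.cons (e false) fun k => B (.inr k))

@[simp] theorem extendLoops_endIdx {S : Type} (e : Bool → S) (B : Fin m ⊕ Fin m → S) (b : Bool) :
    extendLoops e B (endIdx b) = e b := by
  cases b <;> rfl

@[simp] theorem extendLoops_innerIdx {S : Type} (e : Bool → S) (B : Fin m ⊕ Fin m → S)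
    (A : Fin m ⊕ Fin m) : extendLoops e B (innerIdx A) = B A := by
  cases A <;> rfl

theorem isPolyMap_mkRep {W : Type} [AddCommGroup W] [Module ℂ W] {ℓ : ℕ}
    {B : W → Fin ℓ ⊕ Fin ℓ → sl (Fin 2) ℂ} {i j : W → Fin 2 → ℂ}
    (hB : ∀ A, IsPolyMap fun w => B w A) (hi : IsPolyMap i) (hj : IsPolyMap j) :
    IsPolyMap fun w => mkRep (B w) (i w) (j w) :=
  (IsPolyMap.pi fun k => hB (.inl k)).prodMk
    ((IsPolyMap.pi fun k => hB (.inr k)).prodMk (hi.prodMk hj))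

/-- Adding a zero loop. -/
def insertRep (x : QuiverRep 2 m) : QuiverRep 2 (m + 1) :=
  mkRep (extendLoops 0 fun A => loopSl A x) x.2.2.1 x.2.2.2

/-- Forgetting the first loop. -/
def dropRep (x : QuiverRep 2 (m + 1)) : QuiverRep 2 m :=
  mkRep (fun A => loopSl (innerIdx A) x) x.2.2.1 x.2.2.2

/-- The representations with `X 0 j = e₂` or `Y 0 j = e₂` and the other loops diagonal. -/
def chartRep (b : Bool) (c : Fin m ⊕ Fin m → ℂ) : QuiverRep 2 (m + 1) :=
  mkRep (extendLoops (fun b' => if b' = b then lowerSl 1 else 0) fun A => diagSl (c A)) 0 ![1, 0]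

@[simp] theorem loopMat_insertRep_endIdx (b : Bool) (x : QuiverRep 2 m) :
    loopMat (endIdx b) (insertRep x) = 0 := by
  rw [insertRep, loopMat_mkRep, extendLoops_endIdx]; rfl

@[simp] theorem loopMat_insertRep_innerIdx (A : Fin m ⊕ Fin m) (x : QuiverRep 2 m) :
    loopMat (innerIdx A) (insertRep x) = loopMat A x := by
  rw [insertRep, loopMat_mkRep, extendLoops_innerIdx]; rfl

@[simp] theorem loopMat_dropRep (A : Fin m ⊕ Fin m) (x : QuiverRep 2 (m + 1)) :
    loopMat A (dropRep x) = loopMat (innerIdx A) x := by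
  rw [dropRep, loopMat_mkRep]; rfl

@[simp] theorem loopMat_chartRep_endIdx (b b' : Bool) (c : Fin m ⊕ Fin m → ℂ) :
    loopMat (endIdx b') (chartRep b c) = if b' = b then !![0, 0; 1, 0] else 0 := by
  rw [chartRep, loopMat_mkRep, extendLoops_endIdx]
  split_ifs <;> rfl

@[simp] theorem loopMat_chartRep_innerIdx (b : Bool) (A : Fin m ⊕ Fin m) (c : Fin m ⊕ Fin m → ℂ) :
    loopMat (innerIdx A) (chartRep b c) = !![c A, 0; 0, -c A] := by
  rw [chartRep, loopMat_mkRep, extendLoops_innerIdx]; rfl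

theorem quiverRep_ext_succ {x y : QuiverRep 2 (m + 1)}
    (he : ∀ b, loopMat (endIdx b) x = loopMat (endIdx b) y)
    (hA : ∀ A, loopMat (innerIdx A) x = loopMat (innerIdx A) y)
    (hi : x.2.2.1 = y.2.2.1) (hj : x.2.2.2 = y.2.2.2) : x = y := by
  refine quiverRep_ext (fun A => ?_) hi hj
  obtain ⟨b, rfl⟩ | ⟨B, rfl⟩ := eq_endIdx_or_innerIdx A
  · exact he b
  · exact hA B

theorem dropRep_insertRep (x : QuiverRep 2 m) : dropRep (insertRep x) = x :=
  quiverRep_ext (fun A => by simp) rfl rfl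

theorem insertRep_dropRep {x : QuiverRep 2 (m + 1)} (h : ∀ b, loopMat (endIdx b) x = 0) :
    insertRep (dropRep x) = x :=
  quiverRep_ext_succ (fun b => by simp [h]) (fun A => by simp) rfl rfl

theorem insertRep_glRep (g : GL (Fin 2) ℂ) (x : QuiverRep 2 m) :
    insertRep (glRep 2 m g x) = glRep 2 (m + 1) g (insertRep x) :=
  quiverRep_ext_succ (fun b => by simp) (fun A => by simp) rfl rfl

theorem isPolyMap_insertRep : IsPolyMap (insertRep (m := m)) := by
  refine isPolyMap_mkRep (fun A => ?_) isPolyMap_covector isPolyMap_vector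
  obtain ⟨b, rfl⟩ | ⟨B, rfl⟩ := eq_endIdx_or_innerIdx A
  · simp only [extendLoops_endIdx]
    exact isPolyMap_const _
  · simp only [extendLoops_innerIdx]
    exact (loopSl B).isPolyMap

theorem isPolyMap_dropRep : IsPolyMap (dropRep (m := m)) :=
  isPolyMap_mkRep (fun A => (loopSl (innerIdx A)).isPolyMap) isPolyMap_covector isPolyMap_vector

theorem isPolyMap_chartRep (b : Bool) : IsPolyMap (chartRep (m := m) b) := by
  refine isPolyMap_mkRep (fun A => ?_) (isPolyMap_const _) (isPolyMap_const _)
  obtain ⟨b', rfl⟩ | ⟨B, rfl⟩ := eq_endIdx_or_innerIdx A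
  · simp only [extendLoops_endIdx]
    exact isPolyMap_const _
  · simp only [extendLoops_innerIdx]
    refine IsPolyMap.of_injective slVal Subtype.val_injective (isPolyMap_matrix_iff.2 ?_)
    have h : (fun c : Fin m ⊕ Fin m → ℂ => c B) ∈ polyFun (Fin m ⊕ Fin m → ℂ) :=
      dual_mem_polyFun (LinearMap.proj B : (Fin m ⊕ Fin m → ℂ) →ₗ[ℂ] ℂ)
    intro r s
    fin_cases r <;> fin_cases s
    · exact h
    · exact const_mem_polyFun 0
    · exact const_mem_polyFun 0
    · exact neg_mem h

theorem momentMap_succ (x : QuiverRep 2 (m + 1)) :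
    momentMap 2 (m + 1) x = (loopMat (endIdx true) x * loopMat (endIdx false) x -
      loopMat (endIdx false) x * loopMat (endIdx true) x) + momentMap 2 m (dropRep x) := by
  simp only [momentMap, Fin.sum_univ_succ]
  exact add_sub_assoc _ _ _

/-- Diagonal matrices commute, so only the framing term survives. -/
theorem momentMap_of_diagonal {ℓ : ℕ} {x : QuiverRep 2 ℓ}
    (h : ∀ A, loopMat A x = !![loopMat A x 0 0, 0; 0, -loopMat A x 0 0]) :
    momentMap 2 ℓ x = -Matrix.vecMulVec x.2.2.2 x.2.2.1 := by
  have h0 : ∀ k, (x.1 k).1 * (x.2.1 k).1 - (x.2.1 k).1 * (x.1 k).1 = 0 := fun k => by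
    show loopMat (.inl k) x * loopMat (.inr k) x - loopMat (.inr k) x * loopMat (.inl k) x = 0
    rw [h (.inl k), h (.inr k)]
    ext r s
    fin_cases r <;> fin_cases s <;> simp [mul_comm]
  simp only [momentMap, h0, Finset.sum_const_zero, zero_sub]

theorem insertRep_mem_momentZero {x : QuiverRep 2 m} :
    insertRep x ∈ momentZero 2 (m + 1) ↔ x ∈ momentZero 2 m := by
  show momentMap 2 (m + 1) _ = 0 ↔ momentMap 2 m _ = 0
  rw [momentMap_succ, dropRep_insertRep]
  simp

theorem frame_innerIdx (A : Fin m ⊕ Fin m) (x : QuiverRep 2 (m + 1)) :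
    frame (innerIdx A) x = frame A (dropRep x) := by
  rw [frame, frame, loopMat_dropRep]
  rfl

theorem frame_innerIdx_insertRep (A : Fin m ⊕ Fin m) (x : QuiverRep 2 m) :
    frame (innerIdx A) (insertRep x) = frame A x := by
  rw [frame_innerIdx, dropRep_insertRep]

/-- A zero loop gives a zero second column. This keeps the piece with one loop less away from the
two affine pieces. -/
theorem det_frame_endIdx_insertRep (b : Bool) (x : QuiverRep 2 m) :
    (frame (endIdx b) (insertRep x)).det = 0 := by
  rw [frame, loopMat_insertRep_endIdx]
  simp

theorem frame_endIdx_chartRep (b : Bool) (c : Fin m ⊕ Fin m → ℂ) :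
    frame (endIdx b) (chartRep b c) = 1 :=
  frame_eq_one_iff.2 ⟨rfl, by simp, by simp⟩

theorem det_frame_endIdx_chartRep {b b' : Bool} (h : b' ≠ b) (c : Fin m ⊕ Fin m → ℂ) :
    (frame (endIdx b') (chartRep b c)).det = 0 := by
  rw [frame, loopMat_chartRep_endIdx, if_neg h]
  simp

theorem insertRep_mem_semistable {x : QuiverRep 2 m}
    (hx : x ∈ semistable (glRep 2 m) (detInv 2) (momentZero 2 m)) :
    insertRep x ∈ semistable (glRep 2 (m + 1)) (detInv 2) (momentZero 2 (m + 1)) := by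
  rw [mem_semistable_iff] at *
  obtain ⟨h, A, hA⟩ := hx
  exact ⟨insertRep_mem_momentZero.2 h, innerIdx A, by rwa [frame_innerIdx_insertRep]⟩

/-- All commutators vanish, because one loop of the first pair is zero and the other pairs are
diagonal; the framing term vanishes with `i = 0`. -/
theorem chartRep_mem_semistable (b : Bool) (c : Fin m ⊕ Fin m → ℂ) :
    chartRep b c ∈ semistable (glRep 2 (m + 1)) (detInv 2) (momentZero 2 (m + 1)) := by
  refine mem_semistable_iff.2 ⟨?_, endIdx b, by rw [frame_endIdx_chartRep]; simp⟩
  show momentMap 2 (m + 1) _ = 0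
  rw [momentMap_succ, momentMap_of_diagonal fun A => by simp]
  have h : (dropRep (chartRep b c)).2.2.1 = 0 := rfl
  rw [h]
  cases b <;> simp

end Extension

/-! ### Torus weights and fixed points in normal form -/

section Torus

variable {ℓ m : ℕ}

/-- The weights of the torus on the loops. -/
def torusWeight (t : Fin ℓ → ℂˣ) (A : Fin ℓ ⊕ Fin ℓ) : ℂ :=
  A.elim (fun k => (t k : ℂ)) (fun k => ((t k)⁻¹ : ℂˣ))

theorem loopMat_torusRep (t : Fin ℓ → ℂˣ) (A : Fin ℓ ⊕ Fin ℓ) (x : QuiverRep 2 ℓ) :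
    loopMat A (torusRep 2 ℓ t x) = torusWeight t A • loopMat A x := by
  cases A <;> rfl

theorem torusWeight_endIdx (d : ℕ) (t : ℂˣ) (b : Bool) :
    torusWeight (nuTilde (m + 1) d t) (endIdx b) = if b then (t : ℂ) ^ d else ((t : ℂ) ^ d)⁻¹ := by
  cases b <;> simp [torusWeight, endIdx, nuTilde]

theorem torusWeight_innerIdx (d : ℕ) (t : ℂˣ) (A : Fin m ⊕ Fin m) :
    torusWeight (nuTilde (m + 1) d t) (innerIdx A) = 1 := by
  cases A <;> simp [torusWeight, innerIdx, nuTilde]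

/-- The torus fixes `j` and rescales `A`, so it only rescales the second column. -/
theorem frame_torusRep (t : Fin ℓ → ℂˣ) (A : Fin ℓ ⊕ Fin ℓ) (x : QuiverRep 2 ℓ) :
    frame A (torusRep 2 ℓ t x) = frame A x * !![1, 0; 0, torusWeight t A] := by
  have hj : (torusRep 2 ℓ t x).2.2.2 = x.2.2.2 := rfl
  rw [frame, frame, loopMat_torusRep, hj, Matrix.smul_mulVec]
  ext r s
  fin_cases r <;> fin_cases s <;> simp [mul_comm]

/-- The group element that realises the torus action on a representation in normal form. -/
theorem eq_diagonal_of_torusRep_eq {t : Fin ℓ → ℂˣ} {A : Fin ℓ ⊕ Fin ℓ} {x : QuiverRep 2 ℓ}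
    {g : GL (Fin 2) ℂ} (hA : frame A x = 1) (h : torusRep 2 ℓ t x = glRep 2 ℓ g x) :
    g.1 = !![1, 0; 0, torusWeight t A] := by
  have h1 := congrArg (frame A) h
  rw [frame_torusRep, frame_glRep, hA, one_mul, mul_one] at h1
  exact h1.symm

/-- These are the entries of `w_B B g = g B` for `g = diag(1, w_A)`. -/
theorem entries_of_torusRep_eq {t : Fin ℓ → ℂˣ} {A : Fin ℓ ⊕ Fin ℓ} {x : QuiverRep 2 ℓ}
    {g : GL (Fin 2) ℂ} (hA : frame A x = 1) (h : torusRep 2 ℓ t x = glRep 2 ℓ g x)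
    (B : Fin ℓ ⊕ Fin ℓ) :
    torusWeight t B * loopMat B x 0 0 = loopMat B x 0 0 ∧
    torusWeight t B * (loopMat B x 0 1 * torusWeight t A) = loopMat B x 0 1 ∧
    torusWeight t B * loopMat B x 1 0 = torusWeight t A * loopMat B x 1 0 := by
  have hg := eq_diagonal_of_torusRep_eq hA h
  have hinv : (g⁻¹).1 * g.1 = 1 := Units.inv_mul g
  have h1 : torusWeight t B • loopMat B x * g.1 = g.1 * loopMat B x := by
    rw [← loopMat_torusRep, h, loopMat_glRep, mul_assoc, hinv, mul_one]
  rw [hg] at h1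
  have h2 := fun r s => congrFun (congrFun h1 r) s
  simp only [Matrix.mul_apply, Fin.sum_univ_two, Matrix.smul_apply, smul_eq_mul] at h2
  refine ⟨?_, ?_, ?_⟩
  · simpa using h2 0 0
  · simpa [mul_assoc] using h2 0 1
  · simpa using h2 1 0

theorem covector_of_torusRep_eq {t : Fin ℓ → ℂˣ} {A : Fin ℓ ⊕ Fin ℓ} {x : QuiverRep 2 ℓ}
    {g : GL (Fin 2) ℂ} (hA : frame A x = 1) (h : torusRep 2 ℓ t x = glRep 2 ℓ g x) :
    x.2.2.1 1 * torusWeight t A = x.2.2.1 1 := by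
  have hg := eq_diagonal_of_torusRep_eq hA h
  have hinv : (g⁻¹).1 * g.1 = 1 := Units.inv_mul g
  have h1 : x.2.2.1 = Matrix.vecMul x.2.2.1 (g⁻¹).1 := congrArg (fun z => z.2.2.1) h
  have h2 : Matrix.vecMul x.2.2.1 g.1 = x.2.2.1 := by
    conv_lhs => rw [h1]
    rw [Matrix.vecMul_vecMul, hinv, Matrix.vecMul_one]
  rw [hg] at h2
  have := congrFun h2 1
  simpa [Matrix.vecMul, dotProduct] using this

theorem eq_zero_of_mul_eq {a b : ℂ} (ha : a ≠ 1) (h : a * b = b) : b = 0 := by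
  by_contra hb
  exact ha (mul_right_cancel₀ hb (h.trans (one_mul b).symm))

theorem loopMat_eq_zero {A : Fin ℓ ⊕ Fin ℓ} {x : QuiverRep 2 ℓ} (h0 : loopMat A x 0 0 = 0)
    (h1 : loopMat A x 0 1 = 0) (h2 : loopMat A x 1 0 = 0) : loopMat A x = 0 := by
  ext r s
  fin_cases r <;> fin_cases s
  · exact h0
  · exact h1
  · exact h2
  · show loopMat A x 1 1 = 0
    rw [loopMat_one_one, h0, neg_zero]

/-- Here the weight of the framing loop is `1`, so the group element is trivial, while `X 0` and `Y
0` have weights `2` and `1/2`. -/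
theorem loopMat_endIdx_of_fixed {d : ℕ} {t : ℂˣ} (ht : (t : ℂ) ^ d = 2) {A : Fin m ⊕ Fin m}
    {x : QuiverRep 2 (m + 1)} {g : GL (Fin 2) ℂ} (hA : frame (innerIdx A) x = 1)
    (h : torusRep 2 (m + 1) (nuTilde (m + 1) d t) x = glRep 2 (m + 1) g x) (b : Bool) :
    loopMat (endIdx b) x = 0 := by
  obtain ⟨h0, h1, h2⟩ := entries_of_torusRep_eq hA h (endIdx b)
  rw [torusWeight_innerIdx] at h1 h2
  rw [mul_one] at h1
  rw [one_mul] at h2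
  have hw : torusWeight (nuTilde (m + 1) d t) (endIdx b) ≠ 1 := by
    rw [torusWeight_endIdx, ht]
    cases b <;> norm_num
  exact loopMat_eq_zero (eq_zero_of_mul_eq hw h0) (eq_zero_of_mul_eq hw h1)
    (eq_zero_of_mul_eq hw h2)

/-- The weight equations leave only the diagonals of the inner loops, the upper right entry of the
other loop of the first pair and the first entry of `i`. The moment equation removes the last two.
-/
theorem eq_chartRep_of_fixed {d : ℕ} {t : ℂˣ} (ht : (t : ℂ) ^ d = 2) {b : Bool}
    {x : QuiverRep 2 (m + 1)} {g : GL (Fin 2) ℂ} (hb : frame (endIdx b) x = 1)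
    (hx : x ∈ momentZero 2 (m + 1))
    (h : torusRep 2 (m + 1) (nuTilde (m + 1) d t) x = glRep 2 (m + 1) g x) :
    x = chartRep b fun A => loopMat (innerIdx A) x 0 0 := by
  obtain ⟨hj, hb0, hb1⟩ := frame_eq_one_iff.1 hb
  set w := torusWeight (nuTilde (m + 1) d t) (endIdx b) with hw
  have hwv : w = if b then 2 else 2⁻¹ := by rw [hw, torusWeight_endIdx, ht]
  have hw1 : w ≠ 1 := by rw [hwv]; cases b <;> norm_num
  -- The off-diagonal entries of the first pair are governed by `w ^ 2`, so `w ≠ 1` alone would not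
  -- suffice.
  have hww : w * w ≠ 1 := by rw [hwv]; cases b <;> norm_num
  have hinner : ∀ A, loopMat (innerIdx A) x =
      !![loopMat (innerIdx A) x 0 0, 0; 0, -loopMat (innerIdx A) x 0 0] := fun A => by
    obtain ⟨-, h1, h2⟩ := entries_of_torusRep_eq hb h (innerIdx A)
    rw [torusWeight_innerIdx, one_mul, mul_comm] at h1
    rw [torusWeight_innerIdx, one_mul] at h2
    have h01 := eq_zero_of_mul_eq hw1 h1
    have h10 := eq_zero_of_mul_eq hw1 h2.symm
    ext r s
    fin_cases r <;> fin_cases s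
    · rfl
    · exact h01
    · exact h10
    · exact loopMat_one_one _ _
  have hi1 : x.2.2.1 1 = 0 := by
    have := covector_of_torusRep_eq hb h
    rw [mul_comm] at this
    exact eq_zero_of_mul_eq hw1 this
  have hbb : loopMat (endIdx b) x = !![0, 0; 1, 0] := by
    obtain ⟨-, h1, -⟩ := entries_of_torusRep_eq hb h (endIdx b)
    have h01 : loopMat (endIdx b) x 0 1 = 0 := by
      refine eq_zero_of_mul_eq hww ?_
      rw [← hw] at h1
      linear_combination h1
    ext r s
    fin_cases r <;> fin_cases s
    · exact hb0
    · exact h01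
    · exact hb1
    · show loopMat (endIdx b) x 1 1 = 0
      rw [loopMat_one_one, hb0, neg_zero]
  -- The other loop has weight `w⁻¹`, so its upper right entry has total weight `1` and escapes the
  -- weight equations.
  obtain ⟨y, hy⟩ : ∃ y, loopMat (endIdx !b) x = !![0, y; 0, 0] := by
    obtain ⟨h0, -, h2⟩ := entries_of_torusRep_eq hb h (endIdx !b)
    have hw' : torusWeight (nuTilde (m + 1) d t) (endIdx !b) = w⁻¹ := by
      rw [hwv, torusWeight_endIdx, ht]
      cases b <;> simp
    rw [hw'] at h0 h2
    have hw0 : w ≠ 0 := by rw [hwv]; cases b <;> norm_num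
    have h00 : loopMat (endIdx !b) x 0 0 = 0 :=
      eq_zero_of_mul_eq (fun h => hw1 (inv_eq_one.1 h)) h0
    have h10 : loopMat (endIdx !b) x 1 0 = 0 := by
      refine eq_zero_of_mul_eq hww ?_
      rw [mul_assoc, ← hw] at *
      rw [← h2, mul_inv_cancel_left₀ hw0]
    refine ⟨loopMat (endIdx !b) x 0 1, ?_⟩
    ext r s
    fin_cases r <;> fin_cases s
    · exact h00
    · rfl
    · exact h10
    · show loopMat (endIdx !b) x 1 1 = 0
      rw [loopMat_one_one, h00, neg_zero]
  have hmom : momentMap 2 (m + 1) x = 0 := hx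
  rw [momentMap_succ, momentMap_of_diagonal fun A => by
    rw [loopMat_dropRep]; exact hinner A] at hmom
  have hij : Matrix.vecMulVec (dropRep x).2.2.2 (dropRep x).2.2.1 = !![x.2.2.1 0, 0; 0, 0] := by
    have h1 : (dropRep x).2.2.2 = x.2.2.2 := rfl
    have h2 : (dropRep x).2.2.1 = x.2.2.1 := rfl
    rw [h1, h2, hj]
    ext r s
    fin_cases r <;> fin_cases s <;> simp [Matrix.vecMulVec_apply, hi1]
  rw [hij] at hmom
  have hm0 := congrFun (congrFun hmom 0) 0
  have hm1 := congrFun (congrFun hmom 1) 1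
  -- The commutator of the first pair is `± y diag(1, -1)`, while `j i` has no lower right entry:
  -- that entry gives `y = 0`, and then the upper left one gives `i 0 = 0`.
  obtain ⟨hy0, hi0⟩ : y = 0 ∧ x.2.2.1 0 = 0 := by
    cases b
    · rw [hbb, show endIdx true = endIdx (m := m) !false from rfl, hy] at hm0 hm1
      simp at hm0 hm1
      exact ⟨hm1, by rw [hm1] at hm0; simpa using hm0⟩
    · rw [hbb, show endIdx false = endIdx (m := m) !true from rfl, hy] at hm0 hm1
      simp at hm0 hm1
      exact ⟨hm1, by rw [hm1] at hm0; simpa using hm0⟩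
  refine quiverRep_ext_succ (fun b' => ?_) (fun A => ?_) ?_ hj
  · rw [loopMat_chartRep_endIdx]
    by_cases hbb' : b' = b
    · rw [if_pos hbb', hbb', hbb]
    · rw [if_neg hbb', Bool.eq_not.2 hbb', hy, hy0]
      ext r s
      fin_cases r <;> fin_cases s <;> rfl
  · rw [loopMat_chartRep_innerIdx]
    exact hinner A
  · funext a
    fin_cases a
    · exact hi0
    · exact hi1

theorem torusRep_insertRep (d : ℕ) (t : ℂˣ) (x : QuiverRep 2 m) :
    torusRep 2 (m + 1) (nuTilde (m + 1) d t) (insertRep x) = insertRep x :=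
  quiverRep_ext_succ (fun b => by simp [loopMat_torusRep])
    (fun A => by simp [loopMat_torusRep, torusWeight_innerIdx]) rfl rfl

/-- Conjugation by `diag(1, w)` scales the lower left entry by `w` and fixes diagonal matrices and
`e₁`, exactly as the torus does here. -/
theorem exists_torusRep_chartRep (d : ℕ) (t : ℂˣ) (b : Bool) (c : Fin m ⊕ Fin m → ℂ) :
    ∃ g, torusRep 2 (m + 1) (nuTilde (m + 1) d t) (chartRep b c) =
      glRep 2 (m + 1) g (chartRep b c) := by
  set w := torusWeight (nuTilde (m + 1) d t) (endIdx b) with hw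
  have hw0 : w ≠ 0 := by
    rw [hw, torusWeight_endIdx]
    have := pow_ne_zero d t.ne_zero
    cases b <;> simp
  refine ⟨diagGL 1 w one_ne_zero hw0, quiverRep_ext_succ (fun b' => ?_) (fun A => ?_) ?_ ?_⟩
  · rw [loopMat_torusRep, loopMat_glRep, coe_diagGL, coe_diagGL_inv, loopMat_chartRep_endIdx]
    by_cases hb : b' = b
    · rw [if_pos hb, hb, ← hw]
      ext r s
      fin_cases r <;> fin_cases s <;> simp
    · simp [if_neg hb]
  · rw [loopMat_torusRep, loopMat_glRep, coe_diagGL, coe_diagGL_inv, loopMat_chartRep_innerIdx,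
      torusWeight_innerIdx]
    ext r s
    fin_cases r <;> fin_cases s <;> simp [mul_comm, hw0]
  · show (0 : Fin 2 → ℂ) = Matrix.vecMul 0 ((diagGL 1 w one_ne_zero hw0)⁻¹).1
    rw [Matrix.zero_vecMul]
  · show ![1, 0] = Matrix.mulVec (diagGL 1 w one_ne_zero hw0).1 ![1, 0]
    rw [coe_diagGL]
    funext a
    fin_cases a <;> simp [Matrix.mulVec, dotProduct]

theorem torusAct_toVariety_eq_iff {t : Fin ℓ → ℂˣ} {x : (SemistableRep ℓ).carrier} :
    torusAct 2 ℓ t (toVariety x) = toVariety x ↔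
      ∃ g, torusRep 2 ℓ t (toRep x) = glRep 2 ℓ g (toRep x) :=
  eq_comm.trans (toVariety_eq_iff (y := semistableAct (glRep 2 ℓ) (detInv 2) (momentZero 2 ℓ)
    (torusRep 2 ℓ) (torusRep_comm 2 ℓ) (torusRep_momentZero 2 ℓ) t x))

end Torus

/-! ### Gluing the pieces into the fixed locus -/

section Comparison

variable {m : ℕ}

/-- The inclusion of the quiver variety with one loop less. -/
def insertMap : (quiverVariety 2 m).carrier → (quiverVariety 2 (m + 1)).carrier :=
  Quot.lift (fun x => toVariety (ofRep (insertRep (toRep x)) (insertRep_mem_semistable x.2)))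
    fun x y h => by
      obtain ⟨g, hg⟩ := orbitClosuresMeet_iff.1 h
      have hg' : toRep y = glRep 2 m g (toRep x) := hg
      refine toVariety_eq_iff.2 ⟨g, ?_⟩
      show insertRep (toRep y) = glRep 2 (m + 1) g (insertRep (toRep x))
      rw [hg', insertRep_glRep]

theorem insertMap_toVariety (x : (SemistableRep m).carrier) : insertMap (toVariety x) =
    toVariety (ofRep (insertRep (toRep x)) (insertRep_mem_semistable (toRep_mem x))) := rfl

theorem isMor_insertMap : IsMor (quiverVariety 2 m) (quiverVariety 2 (m + 1)) insertMap := by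
  refine isMor_quotient (isMor_toVariety.comp fun x => ?_)
  exact morAt_of_toRep ((isPolyMap_insertRep.isMor _).comp (isMor_toRep x))

theorem insertMap_injective : Function.Injective (insertMap (m := m)) := by
  intro p q h
  obtain ⟨x, rfl⟩ := toVariety_surjective p
  obtain ⟨y, rfl⟩ := toVariety_surjective q
  rw [insertMap_toVariety, insertMap_toVariety, toVariety_eq_iff] at h
  obtain ⟨g, hg⟩ := h
  refine toVariety_eq_iff.2 ⟨g, ?_⟩
  show toRep y = glRep 2 m g (toRep x)
  rw [toRep_ofRep, toRep_ofRep, ← insertRep_glRep] at hg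
  rw [← dropRep_insertRep (toRep y), hg, dropRep_insertRep]

theorem insertMap_notMem_frameLocus (p : (quiverVariety 2 m).carrier) (b : Bool) :
    insertMap p ∉ frameLocus (endIdx b) := by
  obtain ⟨x, rfl⟩ := toVariety_surjective p
  rw [insertMap_toVariety, toVariety_mem_frameLocus]
  exact fun h => h (det_frame_endIdx_insertRep b (toRep x))

/-- The affine spaces in the fixed locus. -/
def chartMap (b : Bool) (c : Fin m ⊕ Fin m → ℂ) : (quiverVariety 2 (m + 1)).carrier :=
  toVariety (ofRep (chartRep b c) (chartRep_mem_semistable b c))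

theorem isMor_chartMap (b : Bool) :
    IsMor (affineSpace (Fin m ⊕ Fin m → ℂ)) (quiverVariety 2 (m + 1)) (chartMap b) :=
  isMor_toVariety.comp fun c => morAt_of_toRep ((isPolyMap_chartRep b).isMor c)

theorem normalSection_chartMap (b : Bool) (c : Fin m ⊕ Fin m → ℂ) :
    normalSection (endIdx b) (chartMap b c) = chartRep b c :=
  normalForm_of_frame_eq_one (frame_endIdx_chartRep b c)

/-- Membership in these two open loci tells the affine pieces apart. -/
theorem chartMap_mem_frameLocus_iff {b b' : Bool} {c : Fin m ⊕ Fin m → ℂ} :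
    chartMap b c ∈ frameLocus (endIdx b') ↔ b' = b := by
  rw [chartMap, toVariety_mem_frameLocus]
  constructor
  · intro h
    by_contra hb
    exact h (det_frame_endIdx_chartRep hb c)
  · rintro rfl
    show (frame (endIdx b') (chartRep b' c)).det ≠ 0
    rw [frame_endIdx_chartRep]
    simp

/-- The diagonal entries of the loops that are not moved by the torus. -/
def chartCoord (x : QuiverRep 2 (m + 1)) (A : Fin m ⊕ Fin m) : ℂ := loopMat (innerIdx A) x 0 0

theorem isPolyMap_chartCoord : IsPolyMap (chartCoord (m := m)) :=
  IsPolyMap.pi fun A => isPolyMap_of_mem_polyFun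
    (isPolyMap_matrix_iff.1 (isPolyMap_loopMat (innerIdx A)) 0 0)

theorem chartCoord_chartRep (b : Bool) (c : Fin m ⊕ Fin m → ℂ) : chartCoord (chartRep b c) = c := by
  funext A
  simp [chartCoord]

theorem chartMap_injective (b : Bool) : Function.Injective (chartMap (m := m) b) := by
  intro c c' h
  rw [← chartCoord_chartRep b c, ← normalSection_chartMap, h, normalSection_chartMap,
    chartCoord_chartRep]

section Fixed

variable {d : ℕ}

/-- The fixed points of the one-parameter subgroup. -/
def fixedSet (m d : ℕ) : Set (quiverVariety 2 (m + 1)).carrier :=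
  {p | ∀ t : ℂˣ, torusAct 2 (m + 1) (nuTilde (m + 1) d t) p = p}

theorem insertMap_mem_fixedSet (p : (quiverVariety 2 m).carrier) : insertMap p ∈ fixedSet m d := by
  intro t
  obtain ⟨x, rfl⟩ := toVariety_surjective p
  refine torusAct_toVariety_eq_iff.2 ⟨1, ?_⟩
  rw [toRep_ofRep, torusRep_insertRep, map_one]
  rfl

theorem chartMap_mem_fixedSet (b : Bool) (c : Fin m ⊕ Fin m → ℂ) : chartMap b c ∈ fixedSet m d :=
  fun t => torusAct_toVariety_eq_iff.2 (exists_torusRep_chartRep d t b c)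

/-- A single torus element detects the fixed locus, provided that neither its `d`-th power nor the
square of that power is `1`; the value `2` will do. -/
theorem exists_unit_pow_eq_two (hd : 0 < d) : ∃ t : ℂˣ, (t : ℂ) ^ d = 2 := by
  obtain ⟨z, hz⟩ := IsAlgClosed.exists_pow_nat_eq (2 : ℂ) hd
  have hz0 : z ≠ 0 := by
    rintro rfl
    rw [zero_pow hd.ne'] at hz
    exact two_ne_zero hz.symm
  exact ⟨Units.mk0 z hz0, hz⟩

theorem chartMap_chartCoord (hd : 0 < d) {p : (quiverVariety 2 (m + 1)).carrier}
    (hp : p ∈ fixedSet m d) {b : Bool} (hb : p ∈ frameLocus (endIdx b)) :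
    chartMap b (chartCoord (normalSection (endIdx b) p)) = p := by
  obtain ⟨t, ht⟩ := exists_unit_pow_eq_two hd
  obtain ⟨y, rfl, hy, hs⟩ := exists_normalForm_rep hb
  obtain ⟨g, hg⟩ := torusAct_toVariety_eq_iff.1 (hp t)
  have h := eq_chartRep_of_fixed ht hy (mem_semistable_iff.1 (toRep_mem y)).1 hg
  rw [hs]
  exact congrArg toVariety (Subtype.ext h.symm)

/-- Forgetting the first pair loses nothing here, since it is zero in the normal form; only this
makes the smaller representation satisfy the moment equation. -/
theorem exists_insertMap_dropRep (hd : 0 < d) {p : (quiverVariety 2 (m + 1)).carrier}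
    (hp : p ∈ fixedSet m d) {A : Fin m ⊕ Fin m} (hA : p ∈ frameLocus (innerIdx A)) :
    ∃ h : dropRep (normalSection (innerIdx A) p) ∈
      semistable (glRep 2 m) (detInv 2) (momentZero 2 m), insertMap (toVariety (ofRep _ h)) = p := by
  obtain ⟨t, ht⟩ := exists_unit_pow_eq_two hd
  obtain ⟨y, rfl, hy, hs⟩ := exists_normalForm_rep hA
  obtain ⟨g, hg⟩ := torusAct_toVariety_eq_iff.1 (hp t)
  have hz := loopMat_endIdx_of_fixed ht hy hg
  have hi : insertRep (dropRep (toRep y)) = toRep y := insertRep_dropRep hz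
  have hss : dropRep (toRep y) ∈ semistable (glRep 2 m) (detInv 2) (momentZero 2 m) := by
    refine mem_semistable_iff.2 ⟨?_, A, ?_⟩
    · rw [← insertRep_mem_momentZero, hi]
      exact (mem_semistable_iff.1 (toRep_mem y)).1
    · rw [← frame_innerIdx]
      have hy' : frame (innerIdx A) (toRep y) = 1 := hy
      rw [hy']
      simp
  have hs' : normalSection (innerIdx A) (toVariety y) = toRep y := hs
  refine ⟨by rw [hs']; exact hss, ?_⟩
  simp only [insertMap_toVariety, toRep_ofRep, hs', hi]
  rfl

theorem exists_mem_frameLocus {ℓ : ℕ} (p : (quiverVariety 2 ℓ).carrier) :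
    ∃ A, p ∈ frameLocus A := by
  obtain ⟨x, rfl⟩ := toVariety_surjective p
  obtain ⟨-, A, hA⟩ := mem_semistable_iff.1 (toRep_mem x)
  exact ⟨A, toVariety_mem_frameLocus.2 hA⟩

/-- A fixed point, as a point of the quiver variety. -/
def fixedVal (p : (fixedLocus 2 (m + 1) (nuTilde (m + 1) d)).carrier) :
    (quiverVariety 2 (m + 1)).carrier := p.1

theorem fixedVal_mem (p : (fixedLocus 2 (m + 1) (nuTilde (m + 1) d)).carrier) :
    fixedVal p ∈ fixedSet m d := p.2

theorem fixedVal_injective : Function.Injective (fixedVal (m := m) (d := d)) :=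
  Subtype.val_injective

theorem isMor_fixedVal : IsMor (fixedLocus 2 (m + 1) (nuTilde (m + 1) d)) (quiverVariety 2 (m + 1))
    fixedVal := isMor_val _

theorem isMor_of_fixedVal {X : FunctionSpace}
    {f : X.carrier → (fixedLocus 2 (m + 1) (nuTilde (m + 1) d)).carrier}
    (hf : IsMor X (quiverVariety 2 (m + 1)) fun x => fixedVal (f x)) : IsMor X _ f :=
  fun x => (hf x).codRestrict

/-- The inclusion of the quiver variety with one loop less into the fixed locus. -/
def insertFixed (p : (quiverVariety 2 m).carrier) :
    (fixedLocus 2 (m + 1) (nuTilde (m + 1) d)).carrier := ⟨insertMap p, insertMap_mem_fixedSet p⟩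

/-- The affine spaces, as subspaces of the fixed locus. -/
def chartFixed {N : ℕ} (e : (Fin N → ℂ) ≃ₗ[ℂ] (Fin m ⊕ Fin m → ℂ)) (b : Bool) (c : Fin N → ℂ) :
    (fixedLocus 2 (m + 1) (nuTilde (m + 1) d)).carrier :=
  ⟨chartMap b (e c), chartMap_mem_fixedSet b (e c)⟩

theorem fixedVal_insertFixed (p : (quiverVariety 2 m).carrier) :
    fixedVal (insertFixed (d := d) p) = insertMap p := rfl

variable {N : ℕ} (e : (Fin N → ℂ) ≃ₗ[ℂ] (Fin m ⊕ Fin m → ℂ))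

theorem fixedVal_chartFixed (b : Bool) (c : Fin N → ℂ) :
    fixedVal (chartFixed (d := d) e b c) = chartMap b (e c) := rfl

/-- The decomposition of the fixed locus. -/
def decomposition : ((quiverVariety 2 m).coprod ((affineSpace (Fin N → ℂ)).coprod
    (affineSpace (Fin N → ℂ)))).carrier → (fixedLocus 2 (m + 1) (nuTilde (m + 1) d)).carrier :=
  Sum.elim insertFixed (Sum.elim (chartFixed e true) (chartFixed e false))

theorem isMor_decomposition : IsMor ((quiverVariety 2 m).coprod ((affineSpace (Fin N → ℂ)).coprod
    (affineSpace (Fin N → ℂ)))) _ (decomposition (d := d) e) := by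
  have h : ∀ b, IsMor (affineSpace (Fin N → ℂ)) _ (chartFixed (d := d) e b) := fun b =>
    isMor_of_fixedVal ((isMor_chartMap b).comp e.toLinearMap.isPolyMap.isMor)
  exact isMor_sumElim (isMor_of_fixedVal isMor_insertMap) (isMor_sumElim (h true) (h false))

theorem chartFixed_injective (b : Bool) : Function.Injective (chartFixed (d := d) e b) :=
  fun _ _ h => e.injective (chartMap_injective b (congrArg fixedVal h))

theorem insertFixed_ne_chartFixed (p : (quiverVariety 2 m).carrier) (b : Bool) (c : Fin N → ℂ) :
    insertFixed (d := d) p ≠ chartFixed e b c := fun h => by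
  have h' : insertMap p = chartMap b (e c) := congrArg fixedVal h
  exact insertMap_notMem_frameLocus p b (h' ▸ chartMap_mem_frameLocus_iff.2 rfl)

theorem chartFixed_true_ne_chartFixed_false (c c' : Fin N → ℂ) :
    chartFixed (d := d) e true c ≠ chartFixed e false c' := fun h => by
  have h' : chartMap true (e c) = chartMap false (e c') := congrArg fixedVal h
  have := (chartMap_mem_frameLocus_iff (b := true) (b' := true) (c := e c)).2 rfl
  rw [h', chartMap_mem_frameLocus_iff] at this
  exact absurd this (by decide)

theorem decomposition_injective : Function.Injective (decomposition (d := d) e) :=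
  Function.Injective.sumElim (fun _ _ h => insertMap_injective (congrArg fixedVal h))
    (Function.Injective.sumElim (chartFixed_injective e true) (chartFixed_injective e false)
      (chartFixed_true_ne_chartFixed_false e))
    fun p c => by
      cases c
      · exact insertFixed_ne_chartFixed e p true _
      · exact insertFixed_ne_chartFixed e p false _

theorem eventually_mem_frameLocus {A : Fin (m + 1) ⊕ Fin (m + 1)}
    {p : (fixedLocus 2 (m + 1) (nuTilde (m + 1) d)).carrier} (hp : fixedVal p ∈ frameLocus A) :
    ∀ᶠ q in 𝓝 p, fixedVal q ∈ frameLocus A :=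
  (isMor_fixedVal p).continuousAt.eventually ((isOpen_frameLocus A).mem_nhds hp)

theorem exists_chart_section (hd : 0 < d) {b : Bool}
    {p : (fixedLocus 2 (m + 1) (nuTilde (m + 1) d)).carrier}
    (hp : fixedVal p ∈ frameLocus (endIdx b)) :
    ∃ s : (fixedLocus 2 (m + 1) (nuTilde (m + 1) d)).carrier → (affineSpace (Fin N → ℂ)).carrier,
      MorAt _ (affineSpace (Fin N → ℂ)) s p ∧ ∀ᶠ q in 𝓝 p, chartFixed e b (s q) = q := by
  refine ⟨fun q => e.symm (chartCoord (normalSection (endIdx b) (fixedVal q))), ?_, ?_⟩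
  · exact (e.symm.toLinearMap.isPolyMap.isMor _).comp ((isPolyMap_chartCoord.isMor _).comp
      ((morAt_normalSection hp).comp (isMor_fixedVal p)))
  · filter_upwards [eventually_mem_frameLocus hp] with q hq
    apply fixedVal_injective
    rw [fixedVal_chartFixed, e.apply_symm_apply, chartMap_chartCoord hd (fixedVal_mem q) hq]

theorem exists_insert_section (hd : 0 < d) {A : Fin m ⊕ Fin m}
    {p : (fixedLocus 2 (m + 1) (nuTilde (m + 1) d)).carrier}
    (hp : fixedVal p ∈ frameLocus (innerIdx A)) :
    ∃ s : (fixedLocus 2 (m + 1) (nuTilde (m + 1) d)).carrier → (quiverVariety 2 m).carrier,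
      MorAt _ (quiverVariety 2 m) s p ∧ ∀ᶠ q in 𝓝 p, insertFixed (s q) = q := by
  classical
  obtain ⟨h₀, -⟩ := exists_insertMap_dropRep hd (fixedVal_mem p) hp
  -- A section has to be a total function; the value from `h₀` is a default that never occurs near
  -- `p`.
  let f : (fixedLocus 2 (m + 1) (nuTilde (m + 1) d)).carrier → (SemistableRep m).carrier := fun q =>
    if h : dropRep (normalSection (innerIdx A) (fixedVal q)) ∈
      semistable (glRep 2 m) (detInv 2) (momentZero 2 m) then ofRep _ h else ofRep _ h₀
  refine ⟨fun q => toVariety (f q), (isMor_toVariety _).comp (morAt_of_toRep ?_), ?_⟩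
  · have h1 : MorAt (fixedLocus 2 (m + 1) (nuTilde (m + 1) d)) (affineSpace (QuiverRep 2 m))
        (fun q => dropRep (normalSection (innerIdx A) (fixedVal q))) p :=
      (isPolyMap_dropRep.isMor _).comp ((morAt_normalSection hp).comp (isMor_fixedVal p))
    refine h1.congr ?_
    filter_upwards [eventually_mem_frameLocus hp] with q hq
    obtain ⟨h, -⟩ := exists_insertMap_dropRep hd (fixedVal_mem q) hq
    simp only [f, dif_pos h, toRep_ofRep]
    rfl
  · filter_upwards [eventually_mem_frameLocus hp] with q hq
    obtain ⟨h, hq'⟩ := exists_insertMap_dropRep hd (fixedVal_mem q) hq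
    apply fixedVal_injective
    rw [fixedVal_insertFixed]
    simp only [f, dif_pos h]
    exact hq'

/-- Every point has an invertible frame, and whether its loop belongs to the first pair decides
which piece the section lands in. -/
theorem exists_decomposition_section (hd : 0 < d)
    (p : (fixedLocus 2 (m + 1) (nuTilde (m + 1) d)).carrier) :
    ∃ s, MorAt _ ((quiverVariety 2 m).coprod ((affineSpace (Fin N → ℂ)).coprod
      (affineSpace (Fin N → ℂ)))) s p ∧ ∀ᶠ q in 𝓝 p, decomposition e (s q) = q := by
  obtain ⟨A, hA⟩ := exists_mem_frameLocus (fixedVal p)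
  obtain ⟨b, rfl⟩ | ⟨B, rfl⟩ := eq_endIdx_or_innerIdx A
  · obtain ⟨s, hs, h⟩ := exists_chart_section e hd hA
    cases b
    · exact ⟨fun q => .inr (.inr (s q)), (isMor_inr _).comp ((isMor_inr _).comp hs), h⟩
    · exact ⟨fun q => .inr (.inl (s q)), (isMor_inr _).comp ((isMor_inl _).comp hs), h⟩
  · obtain ⟨s, hs, h⟩ := exists_insert_section hd hA
    exact ⟨fun q => .inl (s q), (isMor_inl _).comp hs, h⟩

end Fixed

end Comparison

end

theorem mainTheorem12 (ℓ d : ℕ) (hℓ : 1 ≤ ℓ) (hd : 0 < d) :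
    Nonempty (FunctionSpace.Iso (fixedLocus 2 ℓ (nuTilde ℓ d))
      ((quiverVariety 2 (ℓ - 1)).coprod
        ((affineSpace (Fin (2 * ℓ - 2) → ℂ)).coprod (affineSpace (Fin (2 * ℓ - 2) → ℂ))))) := by
  obtain ⟨m, rfl⟩ : ∃ m, ℓ = m + 1 := ⟨ℓ - 1, by omega⟩
  -- Both sides have dimension `2 m`, and any linear identification serves.
  have e : (Fin (2 * (m + 1) - 2) → ℂ) ≃ₗ[ℂ] (Fin m ⊕ Fin m → ℂ) :=
    LinearEquiv.ofFinrankEq _ _ (by simp; omega)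
  exact FunctionSpace.nonempty_iso_of_local_sections (isMor_decomposition e)
    (decomposition_injective e) (exists_decomposition_section e hd)
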